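/- Let $K$ be a commutative ring and let $\Lambda$ be the ring of symmetric functions over $K$, i.e. the $K$-algebra of all symmetric formal power series of bounded degree in $x=(x_1,x_2,\dots)$ with coefficients in $K$. For a partition $\lambda$ let $g_\lambda=\sum_T x^T$ be the dual stable Grothendieck polynomial: the sum is over all reverse plane partitions $T$ of shape $\lambda$ (fillings of the boxes of $\lambda$ with positive integers that are weakly increasing along every row and column), and $x^T=\prod_i x_i^{T(i)}$, where $T(i)$ is the number of columns of $T$ that contain $i$. Let $\Delta\colon\Lambda\to\Lambda\otimes_K\Lambda$ be the coproduct $f(x)\mapsto f(x,y)$, that is, the unique $K$-linear map such that, for every $f\in\Lambda$, the image of $\Delta(f)$ under $\Lambda\otimes_K\Lambda\to K[[x,y]]$, $u\otimes v\mapsto u(x)v(y)$, is $f(x_1,x_2,\dots,y_1,y_2,\dots)$. Let $i\colon\Lambda\to K$ be the map $f\mapsto f(1,0,0,\dots)$. The $g_\lambda$ form a $K$-basis of $\Lambda$; let $I\colon\Lambda\to\Lambda$ be the $K$-linear map defined by $I(g_\lambda)=\sum_{\mu\subset\lambda}g_\mu$. Proposition. For every $f\in\Lambda$, $$I(f)(x_1,x_2,\dots)=f(1,x_1,x_2,\dots);$$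 equivalently, identifying $K\otimes_K\Lambda$ with $\Lambda$, $$I=(i\otimes\mathrm{id})\circ\Delta.$$ -/

import Mathlib

open scoped TensorProduct

namespace DualGrothendieck

noncomputable section

/-! ### The ring of symmetric functions

The variables are indexed by `ℕ`: the variable `X n` is $x_{n+1}$. -/

/-- The ring `Λ` of symmetric functions over `K`: formal power series in countably many variables,
invariant under all permutations of the variables, and of bounded degree. -/
def symmFunc (K : Type*) [CommRing K] : Subalgebra K (MvPowerSeries ℕ K) where
  carrier := {f | (∀ σ : Equiv.Perm ℕ, MvPowerSeries.rename σ f = f) ∧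
    ∃ N : ℕ, ∀ d : ℕ →₀ ℕ, N < d.degree → MvPowerSeries.coeff d f = 0}
  mul_mem' := by
    rintro f g ⟨hf, M, hM⟩ ⟨hg, N, hN⟩
    refine ⟨fun σ => by rw [map_mul, hf, hg], M + N, fun d hd => ?_⟩
    classical
    rw [MvPowerSeries.coeff_mul]
    refine Finset.sum_eq_zero fun p hp => ?_
    have h : p.1.degree + p.2.degree = d.degree := by
      rw [← Finset.HasAntidiagonal.mem_antidiagonal.mp hp, map_add]
    by_cases h1 : M < p.1.degree
    · rw [hM _ h1, zero_mul]
    · rw [hN p.2 (by omega), mul_zero]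
  add_mem' := by
    rintro f g ⟨hf, M, hM⟩ ⟨hg, N, hN⟩
    refine ⟨fun σ => by rw [map_add, hf, hg], M + N, fun d hd => ?_⟩
    rw [map_add, hM d (by omega), hN d (by omega), add_zero]
  algebraMap_mem' := by
    intro r
    refine ⟨fun σ => AlgHom.commutes _ r, 0, fun d hd => ?_⟩
    classical
    rw [MvPowerSeries.algebraMap_apply, MvPowerSeries.coeff_C, if_neg]
    rintro rfl
    simp at hd

/-! ### Substitutions -/

/-- The value `f(a 0, a 1, …) = ∑ d, (coeff d f) * ∏ n, a n ^ d n` at a sequence of scalars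
(for series for which this sum is finite). -/
def evalSeq {K : Type*} [CommRing K] (a : ℕ → K) (f : MvPowerSeries ℕ K) : K :=
  ∑ᶠ d : ℕ →₀ ℕ, MvPowerSeries.coeff d f * d.prod fun n k => a n ^ k

/-- The series `f(a 0, a 1, …) = ∑ d, (coeff d f) * ∏ n, a n ^ d n` obtained by substituting the
series `a n` for the variable `X n`, the sum being taken coefficientwise
(for series for which each of these sums is finite). -/
def substSeq {K : Type*} [CommRing K] (a : ℕ → MvPowerSeries ℕ K) (f : MvPowerSeries ℕ K) :
    MvPowerSeries ℕ K :=
  fun e => ∑ᶠ d : ℕ →₀ ℕ,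
    MvPowerSeries.coeff d f * MvPowerSeries.coeff e (d.prod fun n k => a n ^ k)

/-- The sequence `(1, 0, 0, …)`. -/
def oneZeros (K : Type*) [CommRing K] : ℕ → K
  | 0 => 1
  | _ + 1 => 0

/-- The sequence `(1, x₁, x₂, …)`. -/
def oneVars (K : Type*) [CommRing K] : ℕ → MvPowerSeries ℕ K
  | 0 => 1
  | n + 1 => MvPowerSeries.X n

theorem finite_setOf_zero_le_of_succ_eq (N : ℕ) (e : ℕ → ℕ) :
    {d : ℕ →₀ ℕ | d.degree ≤ N ∧ ∀ n, d (n + 1) = e n}.Finite := by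
  refine Set.Finite.of_finite_image (f := fun d : ℕ →₀ ℕ => d 0)
    ((Set.finite_Iic N).subset ?_) ?_
  · rintro _ ⟨d, hd, rfl⟩
    exact (Finsupp.le_degree 0 d).trans hd.1
  · intro d hd d' hd' h
    ext n
    cases n with
    | zero => exact h
    | succ n => rw [hd.2, hd'.2]

theorem finite_support_evalSeq {K : Type*} [CommRing K] {f : MvPowerSeries ℕ K}
    (hf : f ∈ symmFunc K) :
    (Function.support fun d : ℕ →₀ ℕ =>
      MvPowerSeries.coeff d f * d.prod fun n k => oneZeros K n ^ k).Finite := by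
  obtain ⟨-, N, hN⟩ := hf
  refine (finite_setOf_zero_le_of_succ_eq N 0).subset fun d hd => ⟨?_, fun n => ?_⟩
  · by_contra h
    exact hd (by simp [hN d (not_le.mp h)])
  · by_contra h
    refine hd ?_
    have : (d.prod fun n k => oneZeros K n ^ k) = 0 :=
      Finset.prod_eq_zero (Finsupp.mem_support_iff.mpr h) (zero_pow h)
    simp [this]

/-- The map `i : Λ → K`, `f ↦ f(1, 0, 0, …)`. -/
def evalOne (K : Type*) [CommRing K] : symmFunc K →ₗ[K] K where
  toFun f := evalSeq (oneZeros K) f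
  map_add' f g := by
    simp only [evalSeq]
    rw [← finsum_add_distrib (finite_support_evalSeq f.2) (finite_support_evalSeq g.2)]
    exact finsum_congr fun d => by simp [add_mul]
  map_smul' c f := by
    simp only [evalSeq, smul_eq_mul, RingHom.id_apply]
    rw [mul_finsum' _ _ (finite_support_evalSeq f.2)]
    exact finsum_congr fun d => by simp [mul_assoc]

/-- For a symmetric function `f`, the sums that define `f(1, x₁, x₂, …)` are finite. -/
theorem finite_support_substSeq {K : Type*} [CommRing K] {f : MvPowerSeries ℕ K}
    (hf : f ∈ symmFunc K) (e : ℕ →₀ ℕ) :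
    (Function.support fun d : ℕ →₀ ℕ => MvPowerSeries.coeff d f *
      MvPowerSeries.coeff e (d.prod fun n k => oneVars K n ^ k)).Finite := by
  classical
  obtain ⟨-, N, hN⟩ := hf
  refine (finite_setOf_zero_le_of_succ_eq N e).subset fun d hd => ?_
  have hinj : Set.InjOn Nat.succ (Nat.succ ⁻¹' (d.support : Set ℕ)) :=
    Nat.succ_injective.injOn
  have key : (d.prod fun n k => oneVars K n ^ k) =
      MvPowerSeries.monomial (d.comapDomain Nat.succ hinj) (1 : K) := by
    have h1 : (d.prod fun n k => oneVars K n ^ k) =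
        ∏ n ∈ Finset.range (d.support.sup id + 1 + 1), oneVars K n ^ d n := by
      refine Finset.prod_subset (fun n hn => ?_) fun n _ hn => ?_
      · have := Finset.le_sup (f := id) hn
        simp only [id] at this
        simp only [Finset.mem_range]
        omega
      · simp [Finsupp.notMem_support_iff.mp hn]
    rw [h1, Finset.prod_range_succ', MvPowerSeries.monomial_one_eq]
    simp only [oneVars, one_pow, mul_one]
    symm
    refine Finset.prod_subset (fun n hn => ?_) fun n _ hn => ?_
    · have hn' : n + 1 ∈ d.support := by simpa using hn
      have := Finset.le_sup (f := id) hn'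
      simp only [id] at this
      simp only [Finset.mem_range]
      omega
    · have : d (n + 1) = 0 := by simpa using hn
      simp [this]
  refine ⟨?_, fun n => ?_⟩
  · by_contra h
    exact hd (by simp [hN d (not_le.mp h)])
  · by_contra h
    refine hd ?_
    simp only
    rw [key, MvPowerSeries.coeff_monomial_ne, mul_zero]
    rintro rfl
    exact h rfl

/-! ### The coproduct -/

/-- The series `f(x, y) = f(x₁, x₂, …, y₁, y₂, …)` in two countable sets of variables: the
variables of `f` are renamed along a bijection `ℕ ≃ ℕ ⊕ ℕ` (for symmetric `f` its choice is
irrelevant). -/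
def doubleVars {K : Type*} [CommRing K] (f : MvPowerSeries ℕ K) : MvPowerSeries (ℕ ⊕ ℕ) K :=
  MvPowerSeries.rename Equiv.natSumNatEquivNat.symm f

/-- The map `Λ ⊗ Λ → K⟦x, y⟧`, `f ⊗ g ↦ f(x) g(y)`. -/
def tensorToSeries (K : Type*) [CommRing K] :
    symmFunc K ⊗[K] symmFunc K →ₐ[K] MvPowerSeries (ℕ ⊕ ℕ) K :=
  Algebra.TensorProduct.productMap
    ((MvPowerSeries.rename (Function.Embedding.inl : ℕ ↪ ℕ ⊕ ℕ)).comp (symmFunc K).val)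
    ((MvPowerSeries.rename (Function.Embedding.inr : ℕ ↪ ℕ ⊕ ℕ)).comp (symmFunc K).val)

/-- `Δ` is the coproduct of `Λ`: `Δ f` is the element of `Λ(x) ⊗ Λ(y)` that represents
`f(x, y)`. -/
def IsCoproduct {K : Type*} [CommRing K]
    (Δ : symmFunc K →ₗ[K] symmFunc K ⊗[K] symmFunc K) : Prop :=
  ∀ f : symmFunc K, tensorToSeries K (Δ f) = doubleVars (f : MvPowerSeries ℕ K)

/-! ### Dual stable Grothendieck polynomials -/

/-- A reverse plane partition of shape `lam / mu`: a filling of the cells (row, column) by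
elements of `ℕ`, weakly increasing in every row and column. The entry `n` stands for the positive
integer `n + 1`, in accordance with the numbering of the variables. -/
structure RPP (lam mu : YoungDiagram) where
  entry : {c : ℕ × ℕ // c ∈ lam.cells \ mu.cells} → ℕ
  row_weak : ∀ c c', c.1.1 = c'.1.1 → c.1.2 ≤ c'.1.2 → entry c ≤ entry c'
  col_weak : ∀ c c', c.1.2 = c'.1.2 → c.1.1 ≤ c'.1.1 → entry c ≤ entry c'

/-- The pairs `(j, n)` such that column `j` of `T` contains the entry `n`. -/
def RPP.columnEntries {lam mu : YoungDiagram} (T : RPP lam mu) : Finset (ℕ × ℕ) :=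
  Finset.univ.image fun c => (c.1.2, T.entry c)

/-- The exponent of the monomial `x^T`: the exponent of the variable `X n` is the number of columns
of `T` that contain `n`. -/
def RPP.weight {lam mu : YoungDiagram} (T : RPP lam mu) : ℕ →₀ ℕ :=
  ∑ p ∈ T.columnEntries, Finsupp.single p.2 1

theorem RPP.weight_apply {lam mu : YoungDiagram} (T : RPP lam mu) (n : ℕ) :
    T.weight n = (T.columnEntries.filter fun p => p.2 = n).card := by
  rw [RPP.weight, Finsupp.finsetSum_apply, Finset.card_filter]
  exact Finset.sum_congr rfl fun p _ => Finsupp.single_apply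

/-- There are finitely many reverse plane partitions of given shape and weight. -/
instance {lam mu : YoungDiagram} (d : ℕ →₀ ℕ) : Finite {T : RPP lam mu // T.weight = d} := by
  have hmem (T : {T : RPP lam mu // T.weight = d}) (c) : T.1.entry c ∈ d.support := by
    rw [Finsupp.mem_support_iff, ← DFunLike.congr_fun T.2 (T.1.entry c), RPP.weight_apply]
    refine Finset.card_ne_zero_of_mem (a := (c.1.2, T.1.entry c)) ?_
    simp only [Finset.mem_filter, and_true]
    exact Finset.mem_image_of_mem _ (Finset.mem_univ c)
  refine Finite.of_injective
    (β := {c : ℕ × ℕ // c ∈ lam.cells \ mu.cells} → d.support)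
    (fun T c => ⟨T.1.entry c, hmem T c⟩) ?_
  rintro ⟨⟨T, _, _⟩, _⟩ ⟨⟨T', _, _⟩, _⟩ h
  have : T = T' := funext fun c => congrArg Subtype.val (congrFun h c)
  subst this
  rfl

/-- The dual stable Grothendieck polynomial `g_{lam/mu} = ∑ x^T`, summed over the reverse plane
partitions `T` of shape `lam / mu`. -/
def gSkew (K : Type*) [CommRing K] (lam mu : YoungDiagram) : MvPowerSeries ℕ K :=
  fun d => (Nat.card {T : RPP lam mu // T.weight = d} : K)

/-- `g_lam = g_{lam/∅}`. -/
def g (K : Type*) [CommRing K] (lam : YoungDiagram) : MvPowerSeries ℕ K :=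
  gSkew K lam ⊥

/-! ### The map `I` -/

theorem finite_Iic (lam : YoungDiagram) : (Set.Iic lam).Finite := by
  refine Set.Finite.of_finite_image (f := YoungDiagram.cells)
    (lam.cells.powerset.finite_toSet.subset ?_) fun a _ b _ h => YoungDiagram.ext h
  rintro _ ⟨mu, hmu, rfl⟩
  simpa [YoungDiagram.cells_subset_iff] using hmu

/-- The finite set of the partitions `mu ⊂ lam`. -/
def subdiagrams (lam : YoungDiagram) : Finset YoungDiagram :=
  (finite_Iic lam).toFinset

/-- For a basis `b` of `Λ` indexed by partitions, the linear map `Λ → Λ` with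
`b lam ↦ ∑ mu ⊂ lam, b mu`. -/
def sumMap {K : Type*} [CommRing K] (b : Module.Basis YoungDiagram K (symmFunc K)) :
    symmFunc K →ₗ[K] symmFunc K :=
  b.constr K fun lam => ∑ mu ∈ subdiagrams lam, b mu

end

end DualGrothendieck

/-!
For `mu ⊂ lam`, consider the ways to split the layer `lam / mu` by an intermediate shape `nu`, with
weight `x ^ (number of nonempty columns of nu / mu) * y ^ (number of nonempty columns of lam / nu)`.
Their weighted sum is symmetric in `x` and `y`: cutting column after column, one keeps track of the
sum over the cuts of the columns so far that stay at height at least `t`, which for large `t` is no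
longer symmetric but differs from a symmetric value in a way that the next column repairs. In other
words, the operators that remove a layer with `k` nonempty columns, acting on functions of shapes,
commute. The coefficients of `g_lam` are iterated removals of layers, the largest entry going first,
so `g_lam` is symmetric.

The matrix of the coefficients of the `g_lam` at partitions is unitriangular for the dominance
order, hence the `g_lam` form a basis of `Λ`. Elements of `Λ ⊗ Λ` then correspond to finitely
supported families of coefficients at pairs of partitions, and the coproduct of `f` is the element
with the coefficients of `f(x, y)`.

By symmetry, the variable that is set to `1` in `g_lam` may be taken to be the largest one. Its
entries fill a layer `lam / mu`, where `mu ⊂ lam` is arbitrary, and what remains is a reverse plane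
partition of shape `mu`: so `g_lam(1, x) = ∑ mu ⊂ lam, g_mu(x)`.
-/

namespace DualGrothendieck

noncomputable section

/-! ### Refining a layer column by column -/

section Transfer

variable {R : Type*} [CommRing R] {a b a' b' : ℕ} {x y : R}

/-- The weight of a column with cells in the rows `a, …, b - 1` that is cut at height `h`: a factor
`x` for a nonempty upper part and a factor `y` for a nonempty lower part. -/
def columnWeight (x y : R) (a b h : ℕ) : R :=
  (if a < h then x else 1) * (if h < b then y else 1)

/-- The operator that adjoins a column: if `S h` is the weighted number of ways to cut the columns
already present at heights at least `h`, then `columnStep x y a b S t` is the weighted number of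
ways to cut these columns and a new last column, all of them at heights at least `t`. -/
def columnStep (x y : R) (a b : ℕ) (S : ℕ → R) (t : ℕ) : R :=
  ∑ h ∈ Finset.Icc (max t a) b, columnWeight x y a b h * S h

theorem columnStep_of_le {t : ℕ} (ht : t ≤ a) (S : ℕ → R) :
    columnStep x y a b S t = columnStep x y a b S a := by
  simp only [columnStep, max_eq_right ht, max_self]

theorem columnStep_of_lt {t : ℕ} (ht : b < t) (S : ℕ → R) : columnStep x y a b S t = 0 := by
  rw [columnStep, Finset.Icc_eq_empty (by grind), Finset.sum_empty]

theorem columnStep_eq_add {t : ℕ} (hat : a ≤ t) (htb : t ≤ b) (S : ℕ → R) :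
    columnStep x y a b S t = columnWeight x y a b t * S t + columnStep x y a b S (t + 1) := by
  rw [columnStep, columnStep, max_eq_left hat, max_eq_left (hat.trans (Nat.le_add_right t 1)),
    ← Finset.insert_Icc_add_one_left_eq_Icc htb, Finset.sum_insert (by simp)]

/-- The invariant of the column-by-column computation: the values `S t` with `t ≤ a` lie in the
subring `A` (of symmetric elements), and beyond `a` the failure to do so is controlled. -/
structure IsBalanced (A : Subring R) (x y : R) (a b : ℕ) (S : ℕ → R) : Prop where
  mem_of_le : ∀ t ≤ a, S t ∈ A
  mul_sub_mem : ∀ t < b, x * ((1 - y) * S t - S (t + 1)) ∈ A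

variable {A : Subring R} {S : ℕ → R}

theorem IsBalanced.mono (hS : IsBalanced A x y a b S) (ha : a' ≤ a) (hb : b' ≤ b) :
    IsBalanced A x y a' b' S :=
  ⟨fun t ht => hS.mem_of_le t (ht.trans ha), fun t ht => hS.mul_sub_mem t (ht.trans_le hb)⟩

theorem isBalanced_one (hmul : x * y ∈ A) : IsBalanced A x y a b 1 where
  mem_of_le _ _ := A.one_mem
  mul_sub_mem t _ := by
    simpa [mul_sub] using A.neg_mem hmul

theorem IsBalanced.mul_sub_columnStep_mem (hS : IsBalanced A x y a b S) {t : ℕ}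
    (hat : a < t) (htb : t ≤ b) : x * S t - columnStep x y a b S t ∈ A := by
  induction htb using Nat.decreasingInduction with
  | self =>
    have hlast : columnStep x y a b S b = x * S b := by
      rw [columnStep_eq_add hat.le le_rfl, columnStep_of_lt b.lt_succ_self]
      simp [columnWeight, hat]
    simp [hlast]
  | of_succ t htb ih =>
    have hstep := columnStep_eq_add (x := x) (y := y) hat.le htb.le S
    rw [columnWeight, if_pos hat, if_pos htb] at hstep
    convert A.add_mem (hS.mul_sub_mem t htb) (ih (hat.trans t.lt_succ_self)) using 1
    linear_combination -hstep

theorem IsBalanced.columnStep_self_mem (hadd : x + y ∈ A) (hmul : x * y ∈ A) (hab : a ≤ b)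
    (hS : IsBalanced A x y a b S) : columnStep x y a b S a ∈ A := by
  have hSa := hS.mem_of_le a le_rfl
  have hstep := columnStep_eq_add (x := x) (y := y) le_rfl hab S
  rcases hab.eq_or_lt with rfl | hlt
  · rw [columnStep_of_lt a.lt_succ_self] at hstep
    simpa [hstep, columnWeight] using hSa
  · rw [columnWeight, if_neg (lt_irrefl a), if_pos hlt] at hstep
    convert A.sub_mem (A.sub_mem (A.mul_mem (A.sub_mem hadd hmul) hSa) (hS.mul_sub_mem a hlt))
      (hS.mul_sub_columnStep_mem a.lt_succ_self hlt) using 1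
    linear_combination hstep

theorem IsBalanced.columnStep (hadd : x + y ∈ A) (hmul : x * y ∈ A) (hab : a ≤ b)
    (hS : IsBalanced A x y a b S) : IsBalanced A x y a b (columnStep x y a b S) where
  mem_of_le t ht := columnStep_of_le ht S ▸ hS.columnStep_self_mem hadd hmul hab
  mul_sub_mem t htb := by
    have hself := hS.columnStep_self_mem hadd hmul hab
    rcases lt_trichotomy t a with hta | rfl | hat
    · rw [columnStep_of_le hta.le, columnStep_of_le hta]
      convert A.neg_mem (A.mul_mem hmul hself) using 1
      ring
    · have hstep := columnStep_eq_add (x := x) (y := y) le_rfl hab S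
      rw [columnWeight, if_neg (lt_irrefl t), if_pos htb] at hstep
      convert A.mul_mem hmul (A.sub_mem (hS.mem_of_le t le_rfl) hself) using 1
      linear_combination x * hstep
    · have hstep := columnStep_eq_add (x := x) (y := y) hat.le htb.le S
      rw [columnWeight, if_pos hat, if_pos htb] at hstep
      convert A.mul_mem hmul (hS.mul_sub_columnStep_mem hat htb.le) using 1
      linear_combination x * hstep

/-- The weakly decreasing sequences of `n` column heights between `a` and `b` that are at
least `t`. -/
def heights (a b : ℕ → ℕ) (n t : ℕ) : Finset (Fin n → ℕ) :=
  open Classical in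
  (Fintype.piFinset fun j : Fin n => Finset.Icc (a j) (b j)).filter
    fun v => Antitone v ∧ ∀ j, t ≤ v j

theorem mem_heights {a b : ℕ → ℕ} {n t : ℕ} {v : Fin n → ℕ} :
    v ∈ heights a b n t ↔ (∀ j : Fin n, a j ≤ v j ∧ v j ≤ b j) ∧ Antitone v ∧ ∀ j, t ≤ v j := by
  simp only [heights, Finset.mem_filter, Fintype.mem_piFinset, Finset.mem_Icc]

theorem heights_zero (a b : ℕ → ℕ) (t : ℕ) : heights a b 0 t = Finset.univ := by
  ext v
  simp [mem_heights, Subsingleton.antitone, -Finset.univ_unique]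

theorem antitone_snoc_iff {α : Type*} [Preorder α] {n : ℕ} {v : Fin n → α} {h : α} :
    Antitone (Fin.snoc v h : Fin (n + 1) → α) ↔ Antitone v ∧ ∀ j, h ≤ v j := by
  refine ⟨fun H => ⟨fun i j hij => ?_, fun j => ?_⟩, fun ⟨hv, hh⟩ i j hij => ?_⟩
  · simpa using H (Fin.castSucc_le_castSucc_iff.mpr hij)
  · simpa using H (Fin.le_last j.castSucc)
  · induction j using Fin.lastCases with
    | last => induction i using Fin.lastCases <;> simp [hh]
    | cast j =>
      induction i using Fin.lastCases with
      | last => exact absurd hij (by simp [Fin.le_def])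
      | cast i => simpa using hv (Fin.castSucc_le_castSucc_iff.mp hij)

theorem snoc_mem_heights_iff {a b : ℕ → ℕ} {n t h : ℕ} {v : Fin n → ℕ} :
    (Fin.snoc v h : Fin (n + 1) → ℕ) ∈ heights a b (n + 1) t ↔
      h ∈ Finset.Icc (max t (a n)) (b n) ∧ v ∈ heights a b n h := by
  simp only [mem_heights, antitone_snoc_iff, Fin.forall_fin_succ', Fin.snoc_castSucc,
    Fin.snoc_last, Fin.val_castSucc, Fin.val_last, Finset.mem_Icc, max_le_iff]
  grind

/-- The generating function of the ways to cut the columns `0, …, n - 1`, where column `j` has its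
cells in the rows `a j, …, b j - 1`, at weakly decreasing heights that are at least `t`. -/
def transfer (x y : R) (a b : ℕ → ℕ) (n t : ℕ) : R :=
  ∑ v ∈ heights a b n t, ∏ j : Fin n, columnWeight x y (a j) (b j) (v j)

theorem transfer_zero (a b : ℕ → ℕ) : transfer x y a b 0 = 1 := by
  ext t
  simp [transfer, heights_zero]

theorem transfer_succ (a b : ℕ → ℕ) (n : ℕ) :
    transfer x y a b (n + 1) = columnStep x y (a n) (b n) (transfer x y a b n) := by
  ext t
  simp only [transfer, columnStep, Finset.mul_sum]
  rw [Finset.sum_sigma']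
  symm
  refine Finset.sum_bij' (fun s _ => (Fin.snoc s.2 s.1 : Fin (n + 1) → ℕ))
    (fun v _ => ⟨v (Fin.last n), Fin.init v⟩) ?_ ?_ (by simp) (by simp) ?_
  · rintro ⟨h, v⟩ hv
    exact snoc_mem_heights_iff.mpr (Finset.mem_sigma.mp hv)
  · intro v hv
    rw [← Fin.snoc_init_self v] at hv
    exact Finset.mem_sigma.mpr (snoc_mem_heights_iff.mp hv)
  · rintro ⟨h, v⟩ _
    simp [Fin.prod_univ_castSucc, mul_comm]

theorem transfer_mem (hadd : x + y ∈ A) (hmul : x * y ∈ A) {a b : ℕ → ℕ} (ha : Antitone a)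
    (hb : Antitone b) (hab : ∀ n, a n ≤ b n) (n : ℕ) : transfer x y a b n 0 ∈ A := by
  suffices IsBalanced A x y (a n) (b n) (transfer x y a b n) from
    this.mem_of_le 0 (Nat.zero_le _)
  induction n with
  | zero => exact transfer_zero (x := x) (y := y) a b ▸ isBalanced_one hmul
  | succ n ih =>
    rw [transfer_succ]
    exact (ih.columnStep hadd hmul (hab n)).mono (ha n.le_succ) (hb n.le_succ)

end Transfer

/-! ### Layers of Young diagrams -/

section Layers

variable {lam mu nu : YoungDiagram}

theorem mem_subdiagrams : mu ∈ subdiagrams lam ↔ mu ≤ lam := by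
  simp [subdiagrams]

theorem le_iff_colLen_le : mu ≤ lam ↔ ∀ j, mu.colLen j ≤ lam.colLen j := by
  refine ⟨fun h j => ?_, fun h ⟨i, j⟩ hc => YoungDiagram.mem_iff_lt_colLen.mpr
    ((YoungDiagram.mem_iff_lt_colLen.mp hc).trans_le (h j))⟩
  by_contra! hlt
  exact lt_irrefl _
    (YoungDiagram.mem_iff_lt_colLen.mp (h (YoungDiagram.mem_iff_lt_colLen.mpr hlt)))

theorem ext_colLen (h : ∀ j, mu.colLen j = lam.colLen j) : mu = lam :=
  le_antisymm (le_iff_colLen_le.mpr fun j => (h j).le) (le_iff_colLen_le.mpr fun j => (h j).ge)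

theorem colLen_eq_zero {j : ℕ} (h : lam.rowLen 0 ≤ j) : lam.colLen j = 0 := by
  by_contra h0
  have hmem := YoungDiagram.mem_iff_lt_colLen.mpr (Nat.pos_of_ne_zero h0)
  exact absurd (YoungDiagram.mem_iff_lt_rowLen.mp hmem) h.not_gt

theorem rowLen_zero_le (h : mu ≤ lam) : mu.rowLen 0 ≤ lam.rowLen 0 := by
  by_contra! hlt
  exact lt_irrefl _
    (YoungDiagram.mem_iff_lt_rowLen.mp (h (YoungDiagram.mem_iff_lt_rowLen.mpr hlt)))

/-- The Young diagram with given weakly decreasing column lengths. -/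
def ofHeights {n : ℕ} (v : Fin n → ℕ) (hv : Antitone v) : YoungDiagram where
  cells := Finset.univ.biUnion fun j : Fin n => Finset.range (v j) ×ˢ {(j : ℕ)}
  isLowerSet := by
    rintro ⟨i, j⟩ ⟨i', j'⟩ ⟨hi, hj⟩ h
    simp only [Finset.coe_biUnion, Finset.coe_univ, Set.mem_univ, Set.iUnion_true, Set.mem_iUnion,
      Finset.mem_coe, Finset.mem_product, Finset.mem_range, Finset.mem_singleton] at h ⊢
    obtain ⟨k, hik, rfl⟩ := h
    have hk : j' < n := hj.trans_lt k.2
    exact ⟨⟨j', hk⟩, (hi.trans_lt hik).trans_le (hv (show ⟨j', hk⟩ ≤ k from hj)), rfl⟩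

theorem colLen_ofHeights {n : ℕ} (v : Fin n → ℕ) (hv : Antitone v) (j : ℕ) :
    (ofHeights v hv).colLen j = if h : j < n then v ⟨j, h⟩ else 0 := by
  refine eq_of_forall_lt_iff fun i => ?_
  rw [← YoungDiagram.mem_iff_lt_colLen, ← YoungDiagram.mem_cells]
  simp only [ofHeights, Finset.mem_biUnion, Finset.mem_univ, true_and, Finset.mem_product,
    Finset.mem_range, Finset.mem_singleton]
  split_ifs with h
  · exact ⟨by rintro ⟨k, hik, rfl⟩; exact hik, fun hi => ⟨⟨j, h⟩, hi, rfl⟩⟩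
  · simp only [not_lt_zero, iff_false, not_exists, not_and]
    rintro k _ rfl
    exact h k.2

theorem ofHeights_colLen {n : ℕ} (hn : nu.rowLen 0 ≤ n)
    (hv : Antitone fun j : Fin n => nu.colLen j) : ofHeights _ hv = nu := by
  refine ext_colLen fun j => ?_
  rw [colLen_ofHeights]
  split_ifs with hj
  · rfl
  · exact (colLen_eq_zero (hn.trans (not_lt.mp hj))).symm

theorem colLen_mem_heights {n : ℕ} (hmu : mu ≤ nu) (hlam : nu ≤ lam) :
    (fun j : Fin n => nu.colLen j) ∈ heights mu.colLen lam.colLen n 0 :=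
  mem_heights.mpr ⟨fun j => ⟨le_iff_colLen_le.mp hmu j, le_iff_colLen_le.mp hlam j⟩,
    fun i j hij => nu.colLen_anti i j hij, fun _ => Nat.zero_le _⟩

theorem le_ofHeights_le {n : ℕ} (hmu : mu.rowLen 0 ≤ n) {v : Fin n → ℕ}
    (hv : v ∈ heights mu.colLen lam.colLen n 0) :
    mu ≤ ofHeights v (mem_heights.mp hv).2.1 ∧ ofHeights v (mem_heights.mp hv).2.1 ≤ lam := by
  simp only [le_iff_colLen_le, colLen_ofHeights, ← forall_and]
  intro j
  split_ifs with hj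
  · exact (mem_heights.mp hv).1 ⟨j, hj⟩
  · simp [colLen_eq_zero (hmu.trans (not_lt.mp hj))]

/-- The number of nonempty columns of the skew diagram `lam / mu`. -/
def colCount (lam mu : YoungDiagram) : ℕ :=
  ((lam.cells \ mu.cells).image Prod.snd).card

theorem colCount_eq_card {n : ℕ} (hn : lam.rowLen 0 ≤ n) :
    colCount lam mu = (Finset.univ.filter fun j : Fin n => mu.colLen j < lam.colLen j).card := by
  rw [colCount, ← Finset.card_map Fin.valEmbedding]
  congr 1
  ext j
  simp only [Finset.mem_image, Finset.mem_sdiff, YoungDiagram.mem_cells, Prod.exists,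
    exists_eq_right, Finset.mem_map, Finset.mem_filter, Finset.mem_univ, true_and,
    Fin.valEmbedding_apply, YoungDiagram.mem_iff_lt_colLen, not_lt]
  constructor
  · rintro ⟨i, hlam, hmu⟩
    have hj : j < n := by
      by_contra! h
      rw [colLen_eq_zero (hn.trans h)] at hlam
      exact Nat.not_lt_zero _ hlam
    exact ⟨⟨j, hj⟩, hmu.trans_lt hlam, rfl⟩
  · rintro ⟨k, hk, rfl⟩
    exact ⟨_, hk, le_rfl⟩

open Classical in
/-- The finite set of the diagrams `nu` with `mu ⊂ nu ⊂ lam`. -/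
def diagramsBetween (mu lam : YoungDiagram) : Finset YoungDiagram :=
  (subdiagrams lam).filter (mu ≤ ·)

theorem mem_diagramsBetween : nu ∈ diagramsBetween mu lam ↔ mu ≤ nu ∧ nu ≤ lam := by
  simp [diagramsBetween, mem_subdiagrams, and_comm]

theorem sum_diagramsBetween_eq_transfer {R : Type*} [CommRing R] (x y : R) (h : mu ≤ lam) :
    ∑ nu ∈ diagramsBetween mu lam, x ^ colCount nu mu * y ^ colCount lam nu =
      transfer x y mu.colLen lam.colLen (lam.rowLen 0) 0 := by
  refine Finset.sum_bij' (fun nu _ j => nu.colLen j)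
    (fun v hv => ofHeights v (mem_heights.mp hv).2.1) ?_ ?_ ?_ ?_ ?_
  · intro nu hnu
    rw [mem_diagramsBetween] at hnu
    exact colLen_mem_heights hnu.1 hnu.2
  · intro v hv
    exact mem_diagramsBetween.mpr (le_ofHeights_le (rowLen_zero_le h) hv)
  · intro nu hnu
    exact ofHeights_colLen (rowLen_zero_le (mem_diagramsBetween.mp hnu).2) _
  · intro v _
    ext j
    simp [colLen_ofHeights]
  · intro nu hnu
    rw [colCount_eq_card (rowLen_zero_le (mem_diagramsBetween.mp hnu).2),
      colCount_eq_card (lam := lam) le_rfl]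
    simp only [columnWeight, Finset.prod_mul_distrib]
    simp [Finset.prod_ite]

open MvPolynomial in
theorem isSymmetric_sum_diagramsBetween (h : mu ≤ lam) :
    (∑ nu ∈ diagramsBetween mu lam, X 0 ^ colCount nu mu * X 1 ^ colCount lam nu :
      MvPolynomial (Fin 2) ℤ).IsSymmetric := by
  rw [sum_diagramsBetween_eq_transfer _ _ h]
  refine transfer_mem (A := (symmetricSubalgebra (Fin 2) ℤ).toSubring) (fun e => ?_) (fun e => ?_)
    (fun i j hij => mu.colLen_anti i j hij) (fun i j hij => lam.colLen_anti i j hij)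
    (le_iff_colLen_le.mp h) _
  · simpa [Fin.sum_univ_two] using Equiv.sum_comp e (X : Fin 2 → MvPolynomial (Fin 2) ℤ)
  · simpa [Fin.prod_univ_two] using Equiv.prod_comp e (X : Fin 2 → MvPolynomial (Fin 2) ℤ)

theorem coeff_single_add_single_comm {R : Type*} [CommSemiring R] {p : MvPolynomial (Fin 2) R}
    (hp : p.IsSymmetric) (k l : ℕ) :
    p.coeff (Finsupp.single 0 k + Finsupp.single 1 l) =
      p.coeff (Finsupp.single 0 l + Finsupp.single 1 k) := by
  have hswap : (Finsupp.single 0 k + Finsupp.single 1 l : Fin 2 →₀ ℕ).mapDomain (Equiv.swap 0 1) =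
      Finsupp.single 0 l + Finsupp.single 1 k := by
    simp [Finsupp.mapDomain_add, Finsupp.mapDomain_single, add_comm]
  rw [← hswap, ← MvPolynomial.coeff_rename_mapDomain _ (Equiv.injective _) p, hp]

theorem coeff_sum_pow_mul_pow {ι R : Type*} [CommSemiring R] (s : Finset ι) (u v : ι → ℕ)
    (k l : ℕ) :
    MvPolynomial.coeff (Finsupp.single 0 k + Finsupp.single 1 l)
      (∑ i ∈ s, (MvPolynomial.X 0 ^ u i * MvPolynomial.X 1 ^ v i : MvPolynomial (Fin 2) R)) =
    ((s.filter fun i => u i = k ∧ v i = l).card : R) := by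
  rw [MvPolynomial.coeff_sum, Finset.card_filter, Nat.cast_sum]
  refine Finset.sum_congr rfl fun i _ => ?_
  rw [MvPolynomial.X_pow_eq_monomial, MvPolynomial.X_pow_eq_monomial, MvPolynomial.monomial_mul,
    MvPolynomial.coeff_monomial]
  simp [Finsupp.ext_iff, Fin.forall_fin_two]

theorem card_diagramsBetween_comm (h : mu ≤ lam) (k l : ℕ) :
    ((diagramsBetween mu lam).filter fun nu => colCount nu mu = k ∧ colCount lam nu = l).card =
    ((diagramsBetween mu lam).filter fun nu => colCount nu mu = l ∧ colCount lam nu = k).card := by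
  have hcoeff := coeff_single_add_single_comm (isSymmetric_sum_diagramsBetween h) k l
  rw [coeff_sum_pow_mul_pow, coeff_sum_pow_mul_pow] at hcoeff
  exact_mod_cast hcoeff

/-- The operator on functions of Young diagrams that sums over the removal of a layer with `k`
nonempty columns: `layerSum k φ lam` is the sum of `φ mu` over the `mu ⊂ lam` such that `lam / mu`
has `k` nonempty columns. -/
def layerSum (k : ℕ) (φ : YoungDiagram → ℕ) (lam : YoungDiagram) : ℕ :=
  ∑ mu ∈ (subdiagrams lam).filter (colCount lam · = k), φ mu

theorem layerSum_layerSum (k l : ℕ) (φ : YoungDiagram → ℕ) (lam : YoungDiagram) :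
    layerSum k (layerSum l φ) lam = ∑ mu ∈ subdiagrams lam, ((diagramsBetween mu lam).filter
      fun nu => colCount nu mu = l ∧ colCount lam nu = k).card * φ mu := by
  simp only [layerSum, ← smul_eq_mul, ← Finset.sum_const]
  refine Finset.sum_comm' fun nu mu => ?_
  simp only [Finset.mem_filter, mem_subdiagrams, mem_diagramsBetween]
  constructor
  · rintro ⟨⟨hnu, hk⟩, hmu, hl⟩
    exact ⟨⟨⟨hmu, hnu⟩, hl, hk⟩, hmu.trans hnu⟩
  · rintro ⟨⟨⟨hmu, hnu⟩, hl, hk⟩, -⟩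
    exact ⟨⟨hnu, hk⟩, hmu, hl⟩

instance : LeftCommutative layerSum where
  left_comm k l φ := by
    ext lam
    rw [layerSum_layerSum, layerSum_layerSum]
    refine Finset.sum_congr rfl fun mu hmu => ?_
    rw [card_diagramsBetween_comm (mem_subdiagrams.mp hmu)]

end Layers

/-! ### Removing the largest entries of a reverse plane partition -/

/-- A cell of `lam`, in the form of a cell of the skew diagram `lam / ∅`. -/
abbrev Cell (lam : YoungDiagram) : Type :=
  {c : ℕ × ℕ // c ∈ lam.cells \ (⊥ : YoungDiagram).cells}

/-- The element of `lam` with given coordinates, as a cell. -/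
def toCell {lam : YoungDiagram} {c : ℕ × ℕ} (h : c ∈ lam) : Cell lam :=
  ⟨c, by simpa using h⟩

theorem mem_of_cell {lam : YoungDiagram} (c : Cell lam) : c.1 ∈ lam := by
  simpa using c.2

namespace RPP

section Skew

variable {lam mu : YoungDiagram}

theorem ext_entry {T T' : RPP lam mu} (h : ∀ c, T.entry c = T'.entry c) : T = T' := by
  obtain ⟨e, _, _⟩ := T
  obtain ⟨e', _, _⟩ := T'
  obtain rfl : e = e' := funext h
  rfl

theorem weight_apply_ne_zero {T : RPP lam mu} {n : ℕ} :
    T.weight n ≠ 0 ↔ ∃ c, T.entry c = n := by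
  rw [weight_apply, Finset.card_ne_zero]
  constructor
  · rintro ⟨p, hp⟩
    simp only [columnEntries, Finset.mem_filter, Finset.mem_image, Finset.mem_univ,
      true_and] at hp
    obtain ⟨⟨c, rfl⟩, hc⟩ := hp
    exact ⟨c, hc⟩
  · rintro ⟨c, rfl⟩
    exact ⟨_, Finset.mem_filter.mpr ⟨Finset.mem_image_of_mem _ (Finset.mem_univ c), rfl⟩⟩

theorem degree_weight (T : RPP lam mu) : T.weight.degree = T.columnEntries.card := by
  simp [weight, map_sum]

theorem degree_weight_le (T : RPP lam mu) : T.weight.degree ≤ (lam.cells \ mu.cells).card := by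
  rw [degree_weight]
  exact Finset.card_image_le.trans (by simp)

end Skew

variable {lam mu : YoungDiagram} {N : ℕ}

theorem entry_mono (T : RPP lam ⊥) {c c' : Cell lam} (h : c.1 ≤ c'.1) :
    T.entry c ≤ T.entry c' := by
  have hcorner : (c.1.1, c'.1.2) ∈ lam := lam.up_left_mem h.1 le_rfl (mem_of_cell c')
  exact (T.row_weak c (toCell hcorner) rfl h.2).trans (T.col_weak (toCell hcorner) c' rfl h.1)

theorem mem_columnEntries {T : RPP lam ⊥} {p : ℕ × ℕ} :
    p ∈ T.columnEntries ↔ ∃ i, ∃ h : (i, p.1) ∈ lam, T.entry (toCell h) = p.2 := by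
  simp only [columnEntries, Finset.mem_image, Finset.mem_univ, true_and]
  constructor
  · rintro ⟨c, rfl⟩
    exact ⟨c.1.1, mem_of_cell c, rfl⟩
  · rintro ⟨i, h, hp⟩
    exact ⟨toCell h, Prod.ext rfl hp⟩

/-- The restriction of a reverse plane partition to a smaller diagram. -/
def restrict (h : mu ≤ lam) (T : RPP lam ⊥) : RPP mu ⊥ where
  entry c := T.entry (toCell (h (mem_of_cell c)))
  row_weak _ _ hrow hle := T.row_weak _ _ hrow hle
  col_weak _ _ hcol hle := T.col_weak _ _ hcol hle

/-- The extension of a reverse plane partition to a larger diagram by entries `N`. -/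
def extend (lam : YoungDiagram) (N : ℕ) (T : RPP mu ⊥) (hT : ∀ c, T.entry c < N) : RPP lam ⊥ where
  entry c := if h : c.1 ∈ mu then T.entry (toCell h) else N
  row_weak c c' hrow hle := by
    by_cases hc' : c'.1 ∈ mu
    · have hc : c.1 ∈ mu := mu.up_left_mem hrow.le hle hc'
      simpa only [hc, hc', dif_pos] using T.row_weak _ _ hrow hle
    · rw [dif_neg hc']
      split_ifs
      exacts [(hT _).le, le_rfl]
  col_weak c c' hcol hle := by
    by_cases hc' : c'.1 ∈ mu
    · have hc : c.1 ∈ mu := mu.up_left_mem hle hcol.le hc'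
      simpa only [hc, hc', dif_pos] using T.col_weak _ _ hcol hle
    · rw [dif_neg hc']
      split_ifs
      exacts [(hT _).le, le_rfl]

theorem entry_extend_of_mem {T : RPP mu ⊥} {hT : ∀ c, T.entry c < N} {c : Cell lam}
    (hc : c.1 ∈ mu) : (extend lam N T hT).entry c = T.entry (toCell hc) :=
  dif_pos hc

theorem entry_extend_of_notMem {T : RPP mu ⊥} {hT : ∀ c, T.entry c < N} {c : Cell lam}
    (hc : c.1 ∉ mu) : (extend lam N T hT).entry c = N :=
  dif_neg hc

theorem restrict_extend (h : mu ≤ lam) {T : RPP mu ⊥} (hT : ∀ c, T.entry c < N) :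
    (extend lam N T hT).restrict h = T :=
  ext_entry fun c => entry_extend_of_mem (hT := hT) (mem_of_cell c)

open Classical in
/-- The diagram of the cells with entries less than `N`. -/
def below (T : RPP lam ⊥) (N : ℕ) : YoungDiagram where
  cells := lam.cells.filter fun c => ∃ h : c ∈ lam, T.entry (toCell h) < N
  isLowerSet := by
    intro c c' hcc h
    simp only [Finset.coe_filter, YoungDiagram.mem_cells, Set.mem_ofPred_eq] at h ⊢
    obtain ⟨-, h, hN⟩ := h
    have h' : c' ∈ lam := lam.isLowerSet hcc h
    exact ⟨h', h', (T.entry_mono hcc).trans_lt hN⟩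

theorem mem_below {T : RPP lam ⊥} {c : ℕ × ℕ} :
    c ∈ T.below N ↔ ∃ h : c ∈ lam, T.entry (toCell h) < N := by
  rw [← YoungDiagram.mem_cells]
  simp only [below, Finset.mem_filter, YoungDiagram.mem_cells]
  exact ⟨fun h => h.2, fun h => ⟨h.1, h⟩⟩

theorem below_le (T : RPP lam ⊥) (N : ℕ) : T.below N ≤ lam :=
  fun _ hc => (mem_below.mp hc).1

theorem entry_restrict_lt {T : RPP lam ⊥} (hbelow : T.below N = mu) (hle : mu ≤ lam)
    (c : Cell mu) : (T.restrict hle).entry c < N := by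
  subst hbelow
  exact (mem_below.mp (mem_of_cell c)).2

theorem below_extend (h : mu ≤ lam) {T : RPP mu ⊥} (hT : ∀ c, T.entry c < N) :
    (extend lam N T hT).below N = mu := by
  ext c
  rw [YoungDiagram.mem_cells, YoungDiagram.mem_cells, mem_below]
  constructor
  · rintro ⟨hlam, hlt⟩
    by_contra hc
    exact hlt.ne (entry_extend_of_notMem hc)
  · exact fun hc => ⟨h hc, (entry_extend_of_mem hc).trans_lt (hT _)⟩

theorem extend_restrict {T : RPP lam ⊥} (hT : ∀ c, T.entry c ≤ N) (hbelow : T.below N = mu)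
    (hle : mu ≤ lam) :
    extend lam N (T.restrict hle) (entry_restrict_lt hbelow hle) = T := by
  subst hbelow
  refine ext_entry fun c => ?_
  by_cases hc : c.1 ∈ T.below N
  · exact entry_extend_of_mem hc
  · rw [entry_extend_of_notMem hc]
    exact le_antisymm (not_lt.mp fun hlt => hc (mem_below.mpr ⟨mem_of_cell c, hlt⟩)) (hT c)

theorem columnEntries_extend (hle : mu ≤ lam) {T : RPP mu ⊥} (hT : ∀ c, T.entry c < N) :
    (extend lam N T hT).columnEntries =
      ((lam.cells \ mu.cells).image Prod.snd) ×ˢ {N} ∪ T.columnEntries := by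
  ext ⟨j, n⟩
  simp only [mem_columnEntries, Finset.mem_union, Finset.mem_product, Finset.mem_image,
    Finset.mem_sdiff, YoungDiagram.mem_cells, Prod.exists, exists_eq_right, Finset.mem_singleton]
  constructor
  · rintro ⟨i, h, hn⟩
    by_cases hc : (i, j) ∈ mu
    · exact Or.inr ⟨i, hc, (entry_extend_of_mem hc).symm.trans hn⟩
    · exact Or.inl ⟨⟨i, h, hc⟩, hn.symm.trans (entry_extend_of_notMem hc)⟩
  · rintro (⟨⟨i, h, hc⟩, rfl⟩ | ⟨i, hc, hn⟩)
    · exact ⟨i, h, entry_extend_of_notMem hc⟩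
    · exact ⟨i, hle hc, (entry_extend_of_mem hc).trans hn⟩

theorem weight_extend (hle : mu ≤ lam) {T : RPP mu ⊥} (hT : ∀ c, T.entry c < N) :
    (extend lam N T hT).weight = Finsupp.single N (colCount lam mu) + T.weight := by
  have hdisj :
      Disjoint (((lam.cells \ mu.cells).image Prod.snd) ×ˢ {N}) T.columnEntries := by
    rw [Finset.disjoint_left]
    rintro ⟨j, n⟩ hN hT'
    obtain ⟨i, h, hn⟩ := mem_columnEntries.mp hT'
    exact (hT (toCell h)).ne (hn.trans (Finset.mem_singleton.mp (Finset.mem_product.mp hN).2))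
  rw [weight, columnEntries_extend hle, Finset.sum_union hdisj, Finset.sum_product]
  simp [weight, colCount]

theorem weight_eq_single_add_iff {T : RPP lam ⊥} (hT : ∀ c, T.entry c ≤ N)
    (hbelow : T.below N = mu) (hle : mu ≤ lam) {d : ℕ →₀ ℕ} {k : ℕ} (hd : d N = 0) :
    T.weight = Finsupp.single N k + d ↔
      colCount lam mu = k ∧ (T.restrict hle).weight = d := by
  have hlt := entry_restrict_lt hbelow hle
  have hweight : T.weight = Finsupp.single N (colCount lam mu) + (T.restrict hle).weight := by
    rw [← weight_extend hle hlt, extend_restrict hT hbelow]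
  rw [hweight]
  refine ⟨fun h => ?_, fun ⟨hk, hd'⟩ => by rw [hk, hd']⟩
  have hN : (T.restrict hle).weight N = 0 := by
    by_contra h0
    obtain ⟨c, hc⟩ := weight_apply_ne_zero.mp h0
    exact (hlt c).ne hc
  have hk : colCount lam mu = k := by
    simpa [hN, hd] using DFunLike.congr_fun h N
  exact ⟨hk, by simpa [hk] using h⟩

end RPP

/-- The number of reverse plane partitions of shape `lam` and weight `d`: the coefficient of `x ^ d`
in `g_lam`. -/
def rppCount (lam : YoungDiagram) (d : ℕ →₀ ℕ) : ℕ :=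
  Nat.card {T : RPP lam ⊥ // T.weight = d}

theorem coeff_g (K : Type*) [CommRing K] (lam : YoungDiagram) (d : ℕ →₀ ℕ) :
    MvPowerSeries.coeff d (g K lam) = rppCount lam d := rfl

section Count

variable {lam mu : YoungDiagram} {d : ℕ →₀ ℕ} {N k : ℕ}

theorem RPP.entry_lt_of_weight_eq (hd : ∀ n ∈ d.support, n < N) {T : RPP lam ⊥}
    (hT : T.weight = d) (c : Cell lam) : T.entry c < N := by
  subst hT
  exact hd _ (Finsupp.mem_support_iff.mpr (RPP.weight_apply_ne_zero.mpr ⟨c, rfl⟩))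

theorem RPP.entry_le_of_weight_eq (hd : ∀ n ∈ d.support, n < N) {T : RPP lam ⊥}
    (hT : T.weight = Finsupp.single N k + d) (c : Cell lam) : T.entry c ≤ N := by
  refine Nat.lt_succ_iff.mp (RPP.entry_lt_of_weight_eq (fun n hn => ?_) hT c)
  by_contra! hNn
  have hdn : n ∉ d.support := fun h => by have := hd n h; omega
  simp [Finsupp.single_eq_of_ne (show n ≠ N by omega), Finsupp.notMem_support_iff.mp hdn] at hn

/-- Removing the entries `N` of a reverse plane partition of weight `k` at `N` and `d` below `N`,
when the remaining cells are prescribed. -/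
def rppFiberEquiv (hd : ∀ n ∈ d.support, n < N) (hle : mu ≤ lam) (hk : colCount lam mu = k) :
    {T : {T : RPP lam ⊥ // T.weight = Finsupp.single N k + d} // T.1.below N = mu} ≃
      {T : RPP mu ⊥ // T.weight = d} where
  toFun T := ⟨T.1.1.restrict hle,
    ((RPP.weight_eq_single_add_iff (RPP.entry_le_of_weight_eq hd T.1.2) T.2 hle
      (Finsupp.notMem_support_iff.mp fun h => (hd N h).false)).mp T.1.2).2⟩
  invFun T := ⟨⟨RPP.extend lam N T.1 (RPP.entry_lt_of_weight_eq hd T.2), by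
    rw [RPP.weight_extend hle, hk, T.2]⟩, RPP.below_extend hle (RPP.entry_lt_of_weight_eq hd T.2)⟩
  left_inv T := Subtype.ext (Subtype.ext
    (RPP.extend_restrict (RPP.entry_le_of_weight_eq hd T.1.2) T.2 hle))
  right_inv T := Subtype.ext (RPP.restrict_extend hle (RPP.entry_lt_of_weight_eq hd T.2))

theorem rppCount_single_add (lam : YoungDiagram) (k : ℕ) (hd : ∀ n ∈ d.support, n < N) :
    rppCount lam (Finsupp.single N k + d) = layerSum k (fun mu => rppCount mu d) lam := by
  let s := (subdiagrams lam).filter (colCount lam · = k)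
  have mem_s {mu} : mu ∈ s ↔ mu ≤ lam ∧ colCount lam mu = k := by simp [s, mem_subdiagrams]
  let belowN (T : {T : RPP lam ⊥ // T.weight = Finsupp.single N k + d}) : s :=
    ⟨T.1.below N, mem_s.mpr ⟨T.1.below_le N,
      ((RPP.weight_eq_single_add_iff (RPP.entry_le_of_weight_eq hd T.2) rfl (T.1.below_le N)
        (Finsupp.notMem_support_iff.mp fun h => (hd N h).false)).mp T.2).1⟩⟩
  have hfiber (mu : s) : Nat.card {T // belowN T = mu} = rppCount mu d :=
    Nat.card_congr ((Equiv.subtypeEquivRight fun _ => Subtype.ext_iff).trans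
      (rppFiberEquiv hd (mem_s.mp mu.2).1 (mem_s.mp mu.2).2))
  rw [rppCount, ← Nat.card_congr (Equiv.sigmaFiberEquiv belowN), Nat.card_sigma]
  simp only [hfiber]
  exact Finset.sum_coe_sort s fun mu => rppCount mu d

theorem foldr_single_add {α : Type*} (f : ℕ → α → α) [LeftCommutative f] (z : α)
    (hN : d N = 0) (hk : k ≠ 0) :
    ((Finsupp.single N k + d).support.val.map (Finsupp.single N k + d)).foldr f z =
      f k ((d.support.val.map d).foldr f z) := by
  have hNd : N ∉ d.support := Finsupp.notMem_support_iff.mpr hN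
  have hsupp : (Finsupp.single N k + d).support = Finset.cons N d.support hNd := by
    ext n
    by_cases h : n = N
    · subst h
      simp [hk]
    · simp [h, Finsupp.single_eq_of_ne h]
  have hmap : Multiset.map (Finsupp.single N k + d) d.support.val = Multiset.map d d.support.val :=
    Multiset.map_congr rfl fun n hn => by
      simp [Finsupp.single_eq_of_ne (show n ≠ N from fun h => hNd (h ▸ hn))]
  rw [hsupp, Finset.cons_val, Multiset.map_cons, Multiset.foldr_cons, hmap]
  simp [hN]

theorem rppCount_eq_foldr (d : ℕ →₀ ℕ) :
    (fun lam => rppCount lam d) =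
      (d.support.val.map d).foldr layerSum (fun lam => rppCount lam 0) := by
  induction d using Finsupp.induction_on_max with
  | zero => simp
  | single_add N k d hN hk ih =>
    rw [foldr_single_add _ _ (Finsupp.notMem_support_iff.mp fun h => (hN N h).false) hk, ← ih]
    exact funext fun lam => rppCount_single_add lam k hN

theorem rppCount_mapDomain (lam : YoungDiagram) (d : ℕ →₀ ℕ) {f : ℕ → ℕ}
    (hf : Function.Injective f) : rppCount lam (d.mapDomain f) = rppCount lam d := by
  have hvalues : (d.mapDomain f).support.val.map (d.mapDomain f) = d.support.val.map d := by
    rw [Finsupp.mapDomain_support_of_injective hf, Finset.image_val_of_injOn hf.injOn,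
      Multiset.map_map]
    exact Multiset.map_congr rfl fun n _ => Finsupp.mapDomain_apply hf d n
  have hfoldr := congrFun (rppCount_eq_foldr (d.mapDomain f)) lam
  rwa [hvalues, ← rppCount_eq_foldr] at hfoldr

theorem rppCount_eq_zero_of_card_lt (h : lam.card < d.degree) : rppCount lam d = 0 := by
  have : IsEmpty {T : RPP lam ⊥ // T.weight = d} := by
    constructor
    rintro ⟨T, rfl⟩
    exact h.not_ge (T.degree_weight_le.trans (by simp))
  rw [rppCount, Nat.card_of_isEmpty]

end Count

section Rename

variable {K σ τ : Type*} [CommRing K]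

theorem coeff_mapDomain_rename (e : σ ≃ τ) (f : MvPowerSeries σ K) (d : σ →₀ ℕ) :
    MvPowerSeries.coeff (d.mapDomain e) (MvPowerSeries.rename e f) = MvPowerSeries.coeff d f := by
  simpa [Finsupp.embDomain_eq_mapDomain] using
    MvPowerSeries.coeff_embDomain_rename e.toEmbedding f d

theorem rename_eq_self_iff (e : Equiv.Perm σ) (f : MvPowerSeries σ K) :
    MvPowerSeries.rename e f = f ↔
      ∀ d, MvPowerSeries.coeff (d.mapDomain e) f = MvPowerSeries.coeff d f := by
  refine ⟨fun h d => ?_, fun h => MvPowerSeries.ext fun d => ?_⟩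
  · conv_lhs => rw [← h, coeff_mapDomain_rename]
  · obtain ⟨d, rfl⟩ : ∃ d', Finsupp.mapDomain e d' = d :=
      ⟨d.mapDomain e.symm, by rw [← Finsupp.mapDomain_comp]; simp⟩
    rw [coeff_mapDomain_rename, h]

end Rename

theorem g_mem_symmFunc (K : Type*) [CommRing K] (lam : YoungDiagram) : g K lam ∈ symmFunc K := by
  refine ⟨fun σ => (rename_eq_self_iff σ _).mpr fun d => ?_, lam.card, fun d hd => ?_⟩
  · rw [coeff_g, coeff_g, rppCount_mapDomain _ _ σ.injective]
  · rw [coeff_g, rppCount_eq_zero_of_card_lt hd, Nat.cast_zero]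

/-! ### Coefficients of symmetric functions at partitions -/

section PartitionCoeffs

variable {lam mu : YoungDiagram} {K : Type*} [CommRing K]

theorem coeff_mapDomain_of_injective {F : MvPowerSeries ℕ K} (hF : F ∈ symmFunc K) {f : ℕ → ℕ}
    (hf : Function.Injective f) (d : ℕ →₀ ℕ) :
    MvPowerSeries.coeff (d.mapDomain f) F = MvPowerSeries.coeff d F := by
  obtain ⟨σ, hσ⟩ := Equiv.Perm.exists_extending_pair (fun n : d.support => (n : ℕ)) (fun n => f n)
    Subtype.val_injective (hf.comp Subtype.val_injective)
  rw [Finsupp.mapDomain_congr fun n hn => (hσ ⟨n, hn⟩).symm,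
    (rename_eq_self_iff σ F).mp (hF.1 σ)]

theorem rowLen_eq_zero {i : ℕ} (h : lam.colLen 0 ≤ i) : lam.rowLen i = 0 := by
  rw [← YoungDiagram.colLen_transpose]
  exact colLen_eq_zero (by rwa [YoungDiagram.rowLen_transpose])

/-- The partition `lam` as an exponent: the variable `X i` gets the length of row `i`. -/
def rowExp (lam : YoungDiagram) : ℕ →₀ ℕ :=
  Finsupp.onFinset (Finset.range (lam.colLen 0)) lam.rowLen fun i hi => by
    rw [Finset.mem_range]
    by_contra! h
    exact hi (rowLen_eq_zero h)

theorem rowExp_apply (lam : YoungDiagram) (i : ℕ) : rowExp lam i = lam.rowLen i := rfl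

theorem exists_mapDomain_rowExp (d : ℕ →₀ ℕ) :
    ∃ (σ : Equiv.Perm ℕ) (mu : YoungDiagram), (rowExp mu).mapDomain σ = d := by
  obtain ⟨n, hn⟩ := d.support.exists_nat_subset_range
  let v : Fin n → ℕ := fun j => d j
  let τ : Equiv.Perm (Fin n) := Tuple.sort (OrderDual.toDual ∘ v)
  have hv : Antitone (v ∘ τ) := fun i j hij => Tuple.monotone_sort (OrderDual.toDual ∘ v) hij
  let σ : Equiv.Perm ℕ := τ.extendDomain Fin.equivSubtype
  refine ⟨σ, (ofHeights _ hv).transpose, ?_⟩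
  ext j
  obtain ⟨i, rfl⟩ := σ.surjective j
  rw [Finsupp.mapDomain_apply σ.injective, rowExp_apply, YoungDiagram.rowLen_transpose,
    colLen_ofHeights]
  split_ifs with h
  · exact congrArg d (Equiv.Perm.extendDomain_apply_subtype τ Fin.equivSubtype h).symm
  · rw [show σ i = i from Equiv.Perm.extendDomain_apply_not_subtype τ _ h]
    exact (Finsupp.notMem_support_iff.mp fun hi => h (Finset.mem_range.mp (hn hi))).symm

/-- The filling of `lam` whose entries are the row indices. -/
def rowFilling (lam : YoungDiagram) : RPP lam ⊥ where
  entry c := c.1.1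
  row_weak _ _ h _ := h.le
  col_weak _ _ _ h := h

namespace RPP

variable {T : RPP lam ⊥} {j n : ℕ}

/-- The set of the entries of column `j` of a reverse plane partition. -/
def columnSet (T : RPP lam ⊥) (j : ℕ) : Finset ℕ :=
  Finset.univ.image fun i : Fin (lam.colLen j) =>
    T.entry (toCell (YoungDiagram.mem_iff_lt_colLen.mpr i.2))

theorem mem_columnSet : n ∈ T.columnSet j ↔ (j, n) ∈ T.columnEntries := by
  simp only [columnSet, Finset.mem_image, Finset.mem_univ, true_and, mem_columnEntries,
    YoungDiagram.mem_iff_lt_colLen, Fin.exists_iff]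

theorem card_columnSet_le (T : RPP lam ⊥) (j : ℕ) : (T.columnSet j).card ≤ lam.colLen j :=
  Finset.card_image_le.trans (by simp)

theorem card_range_inter_columnSet_le (T : RPP lam ⊥) (j k : ℕ) :
    (Finset.range k ∩ T.columnSet j).card ≤ min k (lam.colLen j) :=
  le_min ((Finset.card_le_card Finset.inter_subset_left).trans_eq (Finset.card_range k))
    ((Finset.card_le_card Finset.inter_subset_right).trans (T.card_columnSet_le j))

theorem weight_apply_eq_card (T : RPP lam ⊥) (n : ℕ) :
    T.weight n =
      ((Finset.range (lam.rowLen 0)).filter fun j => n ∈ T.columnSet j).card := by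
  rw [weight_apply]
  refine Finset.card_nbij' Prod.fst (fun j => (j, n)) ?_ ?_ ?_ fun _ _ => rfl
  · rintro ⟨j, m⟩ h
    obtain ⟨hj, rfl : m = n⟩ := Finset.mem_filter.mp h
    obtain ⟨i, hi, -⟩ := mem_columnEntries.mp hj
    have htop : (0, j) ∈ lam := lam.up_left_mem (Nat.zero_le i) le_rfl hi
    simpa [mem_columnSet] using ⟨YoungDiagram.mem_iff_lt_rowLen.mp htop, hj⟩
  · intro j hj
    simpa [mem_columnSet] using (Finset.mem_filter.mp hj).2
  · rintro ⟨j, m⟩ h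
    obtain ⟨-, rfl : m = n⟩ := Finset.mem_filter.mp h
    rfl

theorem sum_range_weight (T : RPP lam ⊥) (k : ℕ) :
    ∑ i ∈ Finset.range k, T.weight i =
      ∑ j ∈ Finset.range (lam.rowLen 0), (Finset.range k ∩ T.columnSet j).card := by
  simp only [weight_apply_eq_card, ← Finset.filter_mem_eq_inter]
  exact Finset.sum_card_bipartiteAbove_eq_sum_card_bipartiteBelow fun i j => i ∈ T.columnSet j

theorem columnSet_rowFilling (lam : YoungDiagram) (j : ℕ) :
    (rowFilling lam).columnSet j = Finset.range (lam.colLen j) := by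
  ext n
  simp [columnSet, rowFilling, toCell, Fin.exists_iff]

theorem weight_rowFilling (lam : YoungDiagram) : (rowFilling lam).weight = rowExp lam := by
  ext i
  rw [weight_apply_eq_card, rowExp_apply, ← Finset.card_range (lam.rowLen i)]
  congr 1
  ext j
  simp only [columnSet_rowFilling, Finset.mem_filter, Finset.mem_range,
    ← YoungDiagram.mem_iff_lt_colLen, ← YoungDiagram.mem_iff_lt_rowLen, and_iff_right_iff_imp]
  exact lam.up_left_mem (Nat.zero_le i) le_rfl

end RPP

theorem degree_rowExp (lam : YoungDiagram) : (rowExp lam).degree = lam.card := by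
  rw [← RPP.weight_rowFilling, RPP.degree_weight, RPP.columnEntries,
    Finset.card_image_of_injective]
  · simp
  · rintro ⟨⟨i, j⟩, _⟩ ⟨⟨i', j'⟩, _⟩ h
    obtain ⟨rfl, rfl⟩ := Prod.ext_iff.mp h
    rfl

theorem finite_setOf_card_le (n : ℕ) : {lam : YoungDiagram | lam.card ≤ n}.Finite := by
  refine Set.Finite.of_finite_image (f := YoungDiagram.cells)
    ((Finset.range n ×ˢ Finset.range n).powerset.finite_toSet.subset ?_)
    fun a _ b _ h => YoungDiagram.ext h
  rintro _ ⟨lam, hlam, rfl⟩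
  simp only [Finset.coe_powerset, Set.mem_preimage, Set.mem_powerset_iff, Finset.coe_subset]
  rintro ⟨i, j⟩ hc
  have hrow : lam.rowLen i ≤ lam.card :=
    lam.rowLen_eq_card ▸ Finset.card_le_card (Finset.filter_subset _ _)
  have hcol : lam.colLen j ≤ lam.card :=
    lam.colLen_eq_card ▸ Finset.card_le_card (Finset.filter_subset _ _)
  exact Finset.mem_product.mpr
    ⟨Finset.mem_range.mpr ((YoungDiagram.mem_iff_lt_colLen.mp hc).trans_le (hcol.trans hlam)),
      Finset.mem_range.mpr ((YoungDiagram.mem_iff_lt_rowLen.mp hc).trans_le (hrow.trans hlam))⟩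

/-- The coefficients of a symmetric function at the exponents of partitions; they are its
coordinates in the basis of monomial symmetric functions. -/
def partitionCoeffs (K : Type*) [CommRing K] : symmFunc K →ₗ[K] (YoungDiagram →₀ K) where
  toFun f := Finsupp.ofSupportFinite
    (fun mu => MvPowerSeries.coeff (rowExp mu) (f : MvPowerSeries ℕ K)) (by
      obtain ⟨-, N, hN⟩ := f.2
      refine (finite_setOf_card_le N).subset fun mu hmu => ?_
      by_contra h
      exact hmu (hN _ (degree_rowExp mu ▸ not_le.mp h)))
  map_add' f g := by
    ext mu
    simp [Finsupp.ofSupportFinite_coe]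
  map_smul' c f := by
    ext mu
    simp [Finsupp.ofSupportFinite_coe]

theorem partitionCoeffs_injective (K : Type*) [CommRing K] :
    Function.Injective (partitionCoeffs K) := by
  intro f f' h
  refine Subtype.ext (MvPowerSeries.ext fun d => ?_)
  obtain ⟨σ, mu, rfl⟩ := exists_mapDomain_rowExp d
  rw [coeff_mapDomain_of_injective f.2 σ.injective, coeff_mapDomain_of_injective f'.2 σ.injective]
  exact DFunLike.congr_fun h mu

end PartitionCoeffs

/-! ### Unitriangularity in the dominance order -/

section Dominance

variable {lam mu : YoungDiagram}

/-- The number of cells of `lam` in the first `k` rows. The pointwise order of the functions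
`rowSum lam` is the dominance order, extended to partitions of different sizes. -/
def rowSum (lam : YoungDiagram) (k : ℕ) : ℕ :=
  ∑ i ∈ Finset.range k, rowExp lam i

theorem rowSum_eq_sum_min (lam : YoungDiagram) (k : ℕ) :
    rowSum lam k = ∑ j ∈ Finset.range (lam.rowLen 0), min k (lam.colLen j) := by
  have hinter (j : ℕ) : (Finset.range k ∩ Finset.range (lam.colLen j)).card =
      min k (lam.colLen j) := by
    rw [← Finset.card_range (min k (lam.colLen j))]
    congr 1
    ext i
    simp
  rw [rowSum, ← RPP.weight_rowFilling, RPP.sum_range_weight]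
  simp only [RPP.columnSet_rowFilling, hinter]

theorem rowSum_injective : Function.Injective rowSum := by
  intro mu lam h
  have hrow (i : ℕ) : mu.rowLen i = lam.rowLen i := by
    have hsucc := congrFun h (i + 1)
    have hi := congrFun h i
    simp only [rowSum, Finset.sum_range_succ, rowExp_apply] at hsucc hi
    omega
  ext ⟨i, j⟩
  rw [YoungDiagram.mem_cells, YoungDiagram.mem_cells, YoungDiagram.mem_iff_lt_rowLen, hrow,
    ← YoungDiagram.mem_iff_lt_rowLen]

theorem rowSum_eq_card {k : ℕ} (h : lam.colLen 0 ≤ k) : rowSum lam k = lam.card := by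
  rw [← degree_rowExp, Finsupp.degree_apply, rowSum]
  refine (Finset.sum_subset (fun i hi => ?_) fun i _ hi => Finsupp.notMem_support_iff.mp hi).symm
  by_contra hik
  exact Finsupp.mem_support_iff.mp hi
    (rowLen_eq_zero (h.trans (not_lt.mp fun hlt => hik (Finset.mem_range.mpr hlt))))

theorem card_le_of_rowSum_le (h : rowSum mu ≤ rowSum lam) : mu.card ≤ lam.card := by
  have hmax := h (max (mu.colLen 0) (lam.colLen 0))
  rwa [rowSum_eq_card (le_max_left _ _), rowSum_eq_card (le_max_right _ _)] at hmax

theorem wellFounded_rowSum_lt : WellFounded (InvImage (· < ·) rowSum) := by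
  refine Subrelation.wf (fun {mu lam} (h : rowSum mu < rowSum lam) => ?_)
    (measure fun lam => {mu | rowSum mu < rowSum lam}.ncard).wf
  exact Set.ncard_lt_ncard ⟨fun _ hnu => lt_trans hnu h, fun hs => lt_irrefl (rowSum mu) (hs h)⟩
    ((finite_setOf_card_le lam.card).subset fun _ hnu => card_le_of_rowSum_le (le_of_lt hnu))

theorem RPP.rowSum_le_of_weight_eq {T : RPP lam ⊥} (h : T.weight = rowExp mu) :
    rowSum mu ≤ rowSum lam := fun k =>
  calc rowSum mu k = ∑ j ∈ Finset.range (lam.rowLen 0), (Finset.range k ∩ T.columnSet j).card := by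
        rw [rowSum, ← h, T.sum_range_weight]
    _ ≤ ∑ j ∈ Finset.range (lam.rowLen 0), min k (lam.colLen j) :=
        Finset.sum_le_sum fun j _ => T.card_range_inter_columnSet_le j k
    _ = rowSum lam k := (rowSum_eq_sum_min lam k).symm

theorem RPP.columnSet_eq_range {T : RPP lam ⊥} (h : T.weight = rowExp lam) {j : ℕ}
    (hj : j < lam.rowLen 0) : T.columnSet j = Finset.range (lam.colLen j) := by
  have hsum := T.sum_range_weight (lam.colLen j)
  rw [h, ← rowSum, rowSum_eq_sum_min] at hsum
  have hcard := (Finset.sum_eq_sum_iff_of_le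
    fun j' _ => T.card_range_inter_columnSet_le j' (lam.colLen j)).mp hsum.symm j
      (Finset.mem_range.mpr hj)
  rw [min_self] at hcard
  have hsub : Finset.range (lam.colLen j) ⊆ T.columnSet j := by
    refine Finset.inter_eq_left.mp (Finset.eq_of_subset_of_card_le Finset.inter_subset_left ?_)
    rw [hcard, Finset.card_range]
  exact (Finset.eq_of_subset_of_card_le hsub
    ((T.card_columnSet_le j).trans_eq (Finset.card_range _).symm)).symm

theorem eq_val_of_monotone_of_image_eq_range {m : ℕ} {f : Fin m → ℕ} (hf : Monotone f)
    (h : Finset.univ.image f = Finset.range m) : f = Fin.val := by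
  have hinj : Function.Injective f := by
    rw [← Set.injOn_univ, ← Finset.coe_univ, ← Finset.card_image_iff, h]
    simp
  refine ((hf.strictMono_of_injective hinj).range_inj Fin.val_strictMono).mp ?_
  rw [Fin.range_val, ← Set.image_univ, ← Finset.coe_univ, ← Finset.coe_image, h]
  simp

theorem RPP.entry_eq_of_weight_eq {T : RPP lam ⊥} (h : T.weight = rowExp lam) (c : Cell lam) :
    T.entry c = c.1.1 := by
  have hj : c.1.2 < lam.rowLen 0 := YoungDiagram.mem_iff_lt_rowLen.mp
    (lam.up_left_mem (Nat.zero_le c.1.1) le_rfl (mem_of_cell c))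
  let column : Fin (lam.colLen c.1.2) → ℕ := fun i =>
    T.entry (toCell (YoungDiagram.mem_iff_lt_colLen.mpr i.2))
  have hcolumn : column = Fin.val := eq_val_of_monotone_of_image_eq_range
    (fun _ _ hi => T.col_weak _ _ rfl hi) (RPP.columnSet_eq_range h hj)
  exact congrFun hcolumn ⟨c.1.1, YoungDiagram.mem_iff_lt_colLen.mp (mem_of_cell c)⟩

theorem rppCount_rowExp_self (lam : YoungDiagram) : rppCount lam (rowExp lam) = 1 := by
  rw [rppCount, Nat.card_eq_one_iff_unique]
  refine ⟨⟨fun T T' => Subtype.ext (RPP.ext_entry fun c => ?_)⟩,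
    ⟨⟨rowFilling lam, RPP.weight_rowFilling lam⟩⟩⟩
  rw [RPP.entry_eq_of_weight_eq T.2, RPP.entry_eq_of_weight_eq T'.2]

theorem rowSum_le_of_rppCount_ne_zero (h : rppCount lam (rowExp mu) ≠ 0) :
    rowSum mu ≤ rowSum lam := by
  obtain ⟨⟨T, hT⟩⟩ := (Nat.card_ne_zero.mp h).1
  exact RPP.rowSum_le_of_weight_eq hT

end Dominance

section Unitriangular

variable {ι P R M : Type*} [Preorder P] {r : ι → P} [Ring R] [AddCommGroup M] [Module R M]

theorem linearIndependent_of_unitriangular {v : ι → ι →₀ R} (hdiag : ∀ i, v i i = 1)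
    (htri : ∀ i j, v i j ≠ 0 → j = i ∨ r j < r i) : LinearIndependent R v := by
  rw [linearIndependent_iff]
  intro c hc
  by_contra h0
  obtain ⟨i, hi, hmax⟩ := c.support.exists_maximalFor r (Finsupp.support_nonempty_iff.mpr h0)
  have hci := DFunLike.congr_fun hc i
  rw [Finsupp.linearCombination_apply, Finsupp.sum, Finsupp.finsetSum_apply,
    Finset.sum_eq_single i] at hci
  · exact Finsupp.mem_support_iff.mp hi (by simpa [hdiag] using hci)
  · intro j hj hji
    suffices v j i = 0 by simp [this]
    by_contra hv
    rcases htri j i hv with hij | hlt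
    · exact hji hij.symm
    · exact hlt.not_ge (hmax hj hlt.le)
  · exact fun h => absurd hi h

theorem span_eq_top_of_unitriangular {v : ι → ι →₀ R} (hwf : WellFounded (InvImage (· < ·) r))
    (hdiag : ∀ i, v i i = 1) (htri : ∀ i j, v i j ≠ 0 → j = i ∨ r j < r i) :
    Submodule.span R (Set.range v) = ⊤ := by
  classical
  rw [eq_top_iff, ← (Finsupp.basisSingleOne (R := R) (ι := ι)).span_eq, Submodule.span_le]
  rintro _ ⟨i, rfl⟩
  induction i using hwf.induction with
  | _ i ih =>
    have hsingle : Finsupp.basisSingleOne i = v i - (v i).erase i := by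
      rw [eq_sub_iff_add_eq, Finsupp.coe_basisSingleOne, ← hdiag i, Finsupp.single_add_erase]
    rw [hsingle, ← Finsupp.sum_single ((v i).erase i)]
    refine Submodule.sub_mem _ (Submodule.subset_span ⟨i, rfl⟩)
      (Submodule.sum_mem _ fun j hj => ?_)
    rw [Finsupp.support_erase, Finset.mem_erase, Finsupp.mem_support_iff] at hj
    rw [← Finsupp.smul_single_one]
    have hj' := ih j ((htri i j hj.2).resolve_left hj.1)
    exact Submodule.smul_mem _ _ (by simpa using hj')

theorem span_eq_top_of_injective {N : Type*} [AddCommGroup N] [Module R N] {φ : M →ₗ[R] N}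
    (hφ : Function.Injective φ) {v : ι → M} (hv : Submodule.span R (Set.range (φ ∘ v)) = ⊤) :
    Submodule.span R (Set.range v) = ⊤ := by
  rw [Set.range_comp, Submodule.span_image] at hv
  rw [← Submodule.comap_map_eq_of_injective hφ (Submodule.span R (Set.range v)), hv,
    Submodule.comap_top]

end Unitriangular

section Basis

variable (K : Type*) [CommRing K]

/-- The dual stable Grothendieck polynomial `g_lam` as an element of `Λ`. -/
def gSymm (lam : YoungDiagram) : symmFunc K :=
  ⟨g K lam, g_mem_symmFunc K lam⟩

theorem partitionCoeffs_gSymm (lam mu : YoungDiagram) :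
    partitionCoeffs K (gSymm K lam) mu = rppCount lam (rowExp mu) := rfl

theorem partitionCoeffs_gSymm_self (lam : YoungDiagram) :
    partitionCoeffs K (gSymm K lam) lam = 1 := by
  rw [partitionCoeffs_gSymm, rppCount_rowExp_self, Nat.cast_one]

theorem eq_or_rowSum_lt_of_partitionCoeffs_gSymm_ne_zero (lam mu : YoungDiagram)
    (h : partitionCoeffs K (gSymm K lam) mu ≠ 0) : mu = lam ∨ rowSum mu < rowSum lam := by
  rw [partitionCoeffs_gSymm] at h
  have hle := rowSum_le_of_rppCount_ne_zero fun h0 => h (by rw [h0, Nat.cast_zero])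
  exact hle.eq_or_lt.imp_left fun heq => rowSum_injective heq

theorem linearIndependent_gSymm : LinearIndependent K (gSymm K) :=
  LinearIndependent.of_comp (partitionCoeffs K) (linearIndependent_of_unitriangular
    (partitionCoeffs_gSymm_self K) (eq_or_rowSum_lt_of_partitionCoeffs_gSymm_ne_zero K))

theorem span_partitionCoeffs_gSymm :
    Submodule.span K (Set.range (partitionCoeffs K ∘ gSymm K)) = ⊤ :=
  span_eq_top_of_unitriangular wellFounded_rowSum_lt (partitionCoeffs_gSymm_self K)
    (eq_or_rowSum_lt_of_partitionCoeffs_gSymm_ne_zero K)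

/-- The basis of `Λ` that consists of the dual stable Grothendieck polynomials. -/
def gBasis : Module.Basis YoungDiagram K (symmFunc K) :=
  Module.Basis.mk (linearIndependent_gSymm K)
    (span_eq_top_of_injective (partitionCoeffs_injective K) (span_partitionCoeffs_gSymm K)).ge

theorem gBasis_apply (lam : YoungDiagram) : gBasis K lam = gSymm K lam :=
  Module.Basis.mk_apply _ _ lam

/-- The linear isomorphism that takes a symmetric function to its coefficients at the partitions;
its inverse takes the basis vectors to the monomial symmetric functions. -/
def partitionCoeffsEquiv : symmFunc K ≃ₗ[K] (YoungDiagram →₀ K) :=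
  LinearEquiv.ofBijective (partitionCoeffs K) ⟨partitionCoeffs_injective K, by
    rw [← LinearMap.range_eq_top, eq_top_iff, ← span_partitionCoeffs_gSymm K, Submodule.span_le,
      LinearMap.coe_range]
    exact Set.range_comp_subset_range _ _⟩

theorem partitionCoeffsEquiv_apply (f : symmFunc K) (mu : YoungDiagram) :
    partitionCoeffsEquiv K f mu = MvPowerSeries.coeff (rowExp mu) (f : MvPowerSeries ℕ K) := rfl

end Basis

/-! ### Coefficients of `f(x, y)` at pairs of partitions -/

section TwoSetsOfVariables

open MvPowerSeries (rename coeff)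

theorem sumElim_mapDomain {σ τ σ' τ' M : Type*} [AddCommMonoid M] (f : σ → σ') (g : τ → τ')
    (d : σ →₀ M) (e : τ →₀ M) :
    Finsupp.sumElim (d.mapDomain f) (e.mapDomain g) =
      (Finsupp.sumElim d e).mapDomain (Sum.map f g) := by
  simp only [Finsupp.sumElim_eq_add, Finsupp.mapDomain_add, ← Finsupp.mapDomain_comp]
  rfl

theorem coeff_sumElim_rename_mul_rename {σ τ R : Type*} [CommSemiring R] (u : MvPowerSeries σ R)
    (v : MvPowerSeries τ R) (d : σ →₀ ℕ) (e : τ →₀ ℕ) :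
    coeff (Finsupp.sumElim d e) (rename (Function.Embedding.inl : σ ↪ σ ⊕ τ) u *
      rename (Function.Embedding.inr : τ ↪ σ ⊕ τ) v) = coeff d u * coeff e v := by
  classical
  rw [MvPowerSeries.coeff_mul, Finset.sum_eq_single (d.embDomain .inl, e.embDomain .inr),
    MvPowerSeries.coeff_embDomain_rename, MvPowerSeries.coeff_embDomain_rename]
  · rintro ⟨p, q⟩ hpq hne
    by_cases hp : p ∈ Set.range (Finsupp.mapDomain (Function.Embedding.inl : σ ↪ σ ⊕ τ))
    · by_cases hq : q ∈ Set.range (Finsupp.mapDomain (Function.Embedding.inr : τ ↪ σ ⊕ τ))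
      · obtain ⟨d', rfl⟩ := hp
        obtain ⟨e', rfl⟩ := hq
        have hsum : Finsupp.sumElim d' e' = Finsupp.sumElim d e := by
          rw [Finsupp.sumElim_eq_add d' e']
          exact Finset.HasAntidiagonal.mem_antidiagonal.mp hpq
        obtain ⟨rfl, rfl⟩ : d' = d ∧ e' = e :=
          ⟨Finsupp.ext fun s => DFunLike.congr_fun hsum (.inl s),
            Finsupp.ext fun t => DFunLike.congr_fun hsum (.inr t)⟩
        simp only [Finsupp.embDomain_eq_mapDomain, ne_eq, not_true_eq_false] at hne
      · rw [MvPowerSeries.coeff_rename_eq_zero _ _ hq, mul_zero]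
    · rw [MvPowerSeries.coeff_rename_eq_zero _ _ hp, zero_mul]
  · intro h
    refine absurd (Finset.HasAntidiagonal.mem_antidiagonal.mpr ?_) h
    rw [Finsupp.sumElim_eq_add, Finsupp.embDomain_eq_mapDomain, Finsupp.embDomain_eq_mapDomain]
    rfl

variable {K : Type*} [CommRing K]

theorem coeff_tensorToSeries_tmul (u v : symmFunc K) (d e : ℕ →₀ ℕ) :
    coeff (Finsupp.sumElim d e) (tensorToSeries K (u ⊗ₜ v)) =
      coeff d (u : MvPowerSeries ℕ K) * coeff e (v : MvPowerSeries ℕ K) := by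
  rw [tensorToSeries, Algebra.TensorProduct.productMap_apply_tmul]
  exact coeff_sumElim_rename_mul_rename _ _ d e

theorem coeff_mapDomain_tensorToSeries (z : symmFunc K ⊗[K] symmFunc K) (d e : ℕ →₀ ℕ)
    {f f' : ℕ → ℕ} (hf : Function.Injective f) (hf' : Function.Injective f') :
    coeff (Finsupp.sumElim (d.mapDomain f) (e.mapDomain f')) (tensorToSeries K z) =
      coeff (Finsupp.sumElim d e) (tensorToSeries K z) := by
  induction z with
  | zero => simp only [map_zero]
  | add z z' hz hz' => rw [map_add, map_add, map_add, hz, hz']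
  | tmul u v =>
    rw [coeff_tensorToSeries_tmul, coeff_tensorToSeries_tmul,
      coeff_mapDomain_of_injective u.2 hf, coeff_mapDomain_of_injective v.2 hf']

theorem coeff_doubleVars (F : MvPowerSeries ℕ K) (x : ℕ ⊕ ℕ →₀ ℕ) :
    coeff x (doubleVars F) = coeff (x.mapDomain Equiv.natSumNatEquivNat) F := by
  rw [← coeff_mapDomain_rename Equiv.natSumNatEquivNat.symm F, ← Finsupp.mapDomain_comp,
    Equiv.symm_comp_self, Finsupp.mapDomain_id]
  rfl

theorem coeff_doubleVars_mapDomain {F : MvPowerSeries ℕ K} (hF : F ∈ symmFunc K)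
    {f : ℕ → ℕ ⊕ ℕ} (hf : Function.Injective f) (d : ℕ →₀ ℕ) :
    coeff (d.mapDomain f) (doubleVars F) = coeff d F := by
  rw [coeff_doubleVars, ← Finsupp.mapDomain_comp,
    coeff_mapDomain_of_injective hF (Equiv.natSumNatEquivNat.injective.comp hf)]

theorem coeff_mapDomain_doubleVars {F : MvPowerSeries ℕ K} (hF : F ∈ symmFunc K) (d e : ℕ →₀ ℕ)
    {f f' : ℕ → ℕ} (hf : Function.Injective f) (hf' : Function.Injective f') :
    coeff (Finsupp.sumElim (d.mapDomain f) (e.mapDomain f')) (doubleVars F) =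
      coeff (Finsupp.sumElim d e) (doubleVars F) := by
  have hsymm := Equiv.natSumNatEquivNat.symm.injective
  obtain ⟨c, hc⟩ : ∃ c : ℕ →₀ ℕ,
      Finsupp.sumElim d e = c.mapDomain Equiv.natSumNatEquivNat.symm :=
    ⟨(Finsupp.sumElim d e).mapDomain Equiv.natSumNatEquivNat, by
      rw [← Finsupp.mapDomain_comp, Equiv.symm_comp_self, Finsupp.mapDomain_id]⟩
  rw [sumElim_mapDomain, hc, ← Finsupp.mapDomain_comp,
    coeff_doubleVars_mapDomain hF ((hf.sumMap hf').comp hsymm),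
    coeff_doubleVars_mapDomain hF hsymm]

end TwoSetsOfVariables

section Coproduct

open MvPowerSeries (coeff)

variable (K : Type*) [CommRing K]

/-- The linear isomorphism that takes an element of `Λ ⊗ Λ` to its coefficients at the pairs of
partitions. -/
def tensorCoeffs : symmFunc K ⊗[K] symmFunc K ≃ₗ[K] (YoungDiagram × YoungDiagram →₀ K) :=
  (TensorProduct.congr (partitionCoeffsEquiv K) (partitionCoeffsEquiv K)).trans
    (finsuppTensorFinsupp' K YoungDiagram YoungDiagram)

theorem tensorCoeffs_apply (z : symmFunc K ⊗[K] symmFunc K) (p : YoungDiagram × YoungDiagram) :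
    tensorCoeffs K z p =
      coeff (Finsupp.sumElim (rowExp p.1) (rowExp p.2)) (tensorToSeries K z) := by
  induction z with
  | zero => simp only [map_zero, Finsupp.coe_zero, Pi.zero_apply]
  | add z z' hz hz' => rw [map_add, map_add, map_add, Finsupp.add_apply, hz, hz']
  | tmul u v =>
    rw [coeff_tensorToSeries_tmul, tensorCoeffs, LinearEquiv.trans_apply,
      TensorProduct.congr_tmul, finsuppTensorFinsupp'_apply_apply, partitionCoeffsEquiv_apply,
      partitionCoeffsEquiv_apply]

theorem tensorToSeries_injective : Function.Injective (tensorToSeries K) := by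
  intro z z' h
  refine (tensorCoeffs K).injective (Finsupp.ext fun p => ?_)
  rw [tensorCoeffs_apply, tensorCoeffs_apply, h]

variable {K}

theorem exists_mapDomain_sumElim_rowExp (x : ℕ ⊕ ℕ →₀ ℕ) :
    ∃ (σ τ : Equiv.Perm ℕ) (mu nu : YoungDiagram),
      Finsupp.sumElim ((rowExp mu).mapDomain σ) ((rowExp nu).mapDomain τ) = x := by
  obtain ⟨σ, mu, hmu⟩ := exists_mapDomain_rowExp (x.comapDomain Sum.inl Sum.inl_injective.injOn)
  obtain ⟨τ, nu, hnu⟩ := exists_mapDomain_rowExp (x.comapDomain Sum.inr Sum.inr_injective.injOn)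
  exact ⟨σ, τ, mu, nu, by rw [hmu, hnu, Finsupp.comapDomain_sumElim_comapDomain]⟩

theorem finite_support_coeff_doubleVars (f : symmFunc K) :
    (Function.support fun p : YoungDiagram × YoungDiagram =>
      coeff (Finsupp.sumElim (rowExp p.1) (rowExp p.2))
        (doubleVars (f : MvPowerSeries ℕ K))).Finite := by
  obtain ⟨-, N, hN⟩ := f.2
  refine ((finite_setOf_card_le N).prod (finite_setOf_card_le N)).subset fun p hp => ?_
  have hdegree : (Finsupp.sumElim (rowExp p.1) (rowExp p.2)).degree = p.1.card + p.2.card := by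
    rw [Finsupp.sumElim_eq_add, map_add, Finsupp.degree_mapDomain, Finsupp.degree_mapDomain,
      degree_rowExp, degree_rowExp]
  have hle : p.1.card + p.2.card ≤ N := by
    refine not_lt.mp fun hlt => hp ?_
    exact (coeff_doubleVars _ _).trans (hN _ (by rwa [Finsupp.degree_mapDomain, hdegree]))
  exact ⟨(Nat.le_add_right _ _).trans hle, (Nat.le_add_left _ _).trans hle⟩

theorem exists_tensorToSeries_eq_doubleVars (f : symmFunc K) :
    ∃ z, tensorToSeries K z = doubleVars (f : MvPowerSeries ℕ K) := by
  refine ⟨(tensorCoeffs K).symm (Finsupp.ofSupportFinite _ (finite_support_coeff_doubleVars f)),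
    MvPowerSeries.ext fun x => ?_⟩
  obtain ⟨σ, τ, mu, nu, rfl⟩ := exists_mapDomain_sumElim_rowExp x
  rw [coeff_mapDomain_tensorToSeries _ _ _ σ.injective τ.injective,
    coeff_mapDomain_doubleVars f.2 _ _ σ.injective τ.injective, ← tensorCoeffs_apply K _ (mu, nu),
    LinearEquiv.apply_symm_apply, Finsupp.ofSupportFinite_coe]

variable (K)

/-- The coproduct `Δ` of `Λ`, obtained by lifting `f ↦ f(x, y)` along the injective map
`Λ ⊗ Λ → K⟦x, y⟧`. -/
def coproduct : symmFunc K →ₗ[K] symmFunc K ⊗[K] symmFunc K :=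
  (LinearEquiv.ofInjective (tensorToSeries K).toLinearMap (tensorToSeries_injective K)).symm ∘ₗ
    LinearMap.codRestrict (LinearMap.range (tensorToSeries K).toLinearMap)
      ((MvPowerSeries.rename Equiv.natSumNatEquivNat.symm).toLinearMap ∘ₗ
        (symmFunc K).val.toLinearMap) exists_tensorToSeries_eq_doubleVars

theorem isCoproduct_coproduct : IsCoproduct (coproduct K) := fun _ =>
  LinearEquiv.ofInjective_symm_apply (tensorToSeries K).toLinearMap
    (h := tensorToSeries_injective K) _

variable {K}

theorem isCoproduct_iff (Δ : symmFunc K →ₗ[K] symmFunc K ⊗[K] symmFunc K) :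
    IsCoproduct Δ ↔ Δ = coproduct K := by
  constructor
  · intro h
    exact LinearMap.ext fun f =>
      tensorToSeries_injective K ((h f).trans (isCoproduct_coproduct K f).symm)
  · rintro rfl
    exact isCoproduct_coproduct K

end Coproduct

/-! ### Setting the first variable to one -/

section ConsCoeffs

open MvPowerSeries (coeff)

/-- The exponent `(k, e 0, e 1, …)`. -/
def consExp (k : ℕ) (e : ℕ →₀ ℕ) : ℕ →₀ ℕ :=
  Finsupp.single 0 k + e.mapDomain Nat.succ

theorem consExp_apply_zero (k : ℕ) (e : ℕ →₀ ℕ) : consExp k e 0 = k := by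
  rw [consExp, Finsupp.add_apply, Finsupp.single_eq_same,
    Finsupp.mapDomain_of_notMem_range _ _ (by simp), add_zero]

theorem exists_consExp_eq (d : ℕ →₀ ℕ) : ∃ k e, consExp k e = d := by
  refine ⟨d 0, d.comapDomain Nat.succ Nat.succ_injective.injOn, Finsupp.ext fun n => ?_⟩
  cases n with
  | zero => rw [consExp_apply_zero]
  | succ n =>
    rw [consExp, Finsupp.add_apply, Finsupp.single_eq_of_ne n.succ_ne_zero, zero_add]
    exact Finsupp.mapDomain_apply Nat.succ_injective _ n

theorem consExp_injective (e : ℕ →₀ ℕ) : Function.Injective fun k => consExp k e := by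
  intro k k' h
  simpa only [consExp_apply_zero] using DFunLike.congr_fun h 0

theorem degree_consExp (k : ℕ) (e : ℕ →₀ ℕ) : (consExp k e).degree = k + e.degree := by
  rw [consExp, map_add, Finsupp.degree_single, Finsupp.degree_mapDomain]

theorem prod_consExp {R : Type*} [CommMonoid R] (a : ℕ → R) (k : ℕ) (e : ℕ →₀ ℕ) :
    ((consExp k e).prod fun n m => a n ^ m) = a 0 ^ k * e.prod fun n m => a (n + 1) ^ m := by
  rw [consExp, Finsupp.prod_add_index' (by simp) (fun n m m' => pow_add _ _ _),
    Finsupp.prod_single_index (by simp),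
    Finsupp.prod_mapDomain_index (by simp) (fun n m m' => pow_add _ _ _)]

theorem finsum_comp_of_support_subset_range {α β M : Type*} [AddCommMonoid M] {f : β → M}
    {g : α → β} (hg : Function.Injective g) (h : Function.support f ⊆ Set.range g) :
    ∑ᶠ a, f (g a) = ∑ᶠ b, f b := by
  rw [← finsum_mem_range hg, ← finsum_mem_univ f]
  exact finsum_mem_inter_support_eq' f _ _ fun b hb => iff_of_true (h hb) (Set.mem_univ b)

variable {K : Type*} [CommRing K]

theorem prod_consExp_oneVars (k : ℕ) (e : ℕ →₀ ℕ) :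
    ((consExp k e).prod fun n m => oneVars K n ^ m) = MvPowerSeries.monomial e 1 := by
  rw [prod_consExp, MvPowerSeries.monomial_one_eq]
  simp only [oneVars, one_pow, one_mul]

theorem coeff_substSeq_oneVars (F : MvPowerSeries ℕ K) (e : ℕ →₀ ℕ) :
    coeff e (substSeq (oneVars K) F) = ∑ᶠ k, coeff (consExp k e) F := by
  classical
  have hterm (k : ℕ) (e' : ℕ →₀ ℕ) : coeff (consExp k e') F *
      coeff e ((consExp k e').prod fun n m => oneVars K n ^ m) =
        if e = e' then coeff (consExp k e') F else 0 := by
    rw [prod_consExp_oneVars, MvPowerSeries.coeff_monomial, mul_ite, mul_one, mul_zero]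
  refine (finsum_comp_of_support_subset_range (consExp_injective e) fun d hd => ?_).symm.trans
    (finsum_congr fun k => (hterm k e).trans (if_pos rfl))
  obtain ⟨k, e', rfl⟩ := exists_consExp_eq d
  rw [Function.mem_support, hterm, ite_ne_right_iff] at hd
  exact ⟨k, by rw [hd.1]⟩

theorem prod_consExp_oneZeros (k : ℕ) (e : ℕ →₀ ℕ) :
    ((consExp k e).prod fun n m => oneZeros K n ^ m) = 0 ^ e.degree := by
  rw [prod_consExp, Finsupp.degree_apply, ← Finset.prod_pow_eq_pow_sum]
  simp only [oneZeros, one_pow, one_mul, Finsupp.prod]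

theorem evalOne_eq_finsum (f : symmFunc K) :
    evalOne K f = ∑ᶠ k, coeff (consExp k 0) (f : MvPowerSeries ℕ K) := by
  refine (finsum_comp_of_support_subset_range (consExp_injective 0) fun d hd => ?_).symm.trans
    (finsum_congr fun k => by rw [prod_consExp_oneZeros, map_zero, pow_zero, mul_one])
  obtain ⟨k, e, rfl⟩ := exists_consExp_eq d
  have he : e.degree = 0 := by
    by_contra he
    rw [Function.mem_support, prod_consExp_oneZeros, zero_pow he, mul_zero] at hd
    exact hd rfl
  exact ⟨k, by rw [(Finsupp.degree_eq_zero_iff e).mp he]⟩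

variable (K)

/-- The coefficient of the monomial with exponent `e` in the remaining variables, when a symmetric
function is expanded as a series in `x₂, x₃, …` whose coefficients are polynomials in `x₁`; the
polynomial is given by its own coefficients. -/
def consCoeffs (e : ℕ →₀ ℕ) : symmFunc K →ₗ[K] (ℕ →₀ K) where
  toFun f := Finsupp.ofSupportFinite (fun k => coeff (consExp k e) (f : MvPowerSeries ℕ K)) (by
    obtain ⟨-, N, hN⟩ := f.2
    refine (Set.finite_Iic N).subset fun k hk =>
      Set.mem_Iic.mpr (not_lt.mp fun hlt => hk (hN _ ?_))
    rw [degree_consExp]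
    exact Nat.lt_add_right _ hlt)
  map_add' f f' := Finsupp.ext fun k => map_add (coeff (consExp k e)) _ _
  map_smul' c f := Finsupp.ext fun k => map_smul (coeff (consExp k e)) c _

/-- The value at `1` of the polynomial with given coefficients. -/
def coeffSum : (ℕ →₀ K) →ₗ[K] K :=
  Finsupp.linearCombination K fun _ => 1

variable {K}

theorem consCoeffs_apply (e : ℕ →₀ ℕ) (f : symmFunc K) (k : ℕ) :
    consCoeffs K e f k = coeff (consExp k e) (f : MvPowerSeries ℕ K) := rfl

theorem coeffSum_eq_finsum (c : ℕ →₀ K) : coeffSum K c = ∑ᶠ k, c k := by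
  rw [coeffSum, Finsupp.linearCombination_apply,
    finsum_eq_sum_of_support_subset c c.fun_support_eq.subset]
  exact Finset.sum_congr rfl fun k _ => mul_one _

theorem coeffSum_consCoeffs (f : symmFunc K) (e : ℕ →₀ ℕ) :
    coeffSum K (consCoeffs K e f) = coeff e (substSeq (oneVars K) (f : MvPowerSeries ℕ K)) := by
  rw [coeffSum_eq_finsum, coeff_substSeq_oneVars]
  rfl

theorem coeffSum_consCoeffs_zero (f : symmFunc K) :
    coeffSum K (consCoeffs K 0 f) = evalOne K f := by
  rw [coeffSum_eq_finsum, evalOne_eq_finsum]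
  rfl

end ConsCoeffs

section SumOverSubdiagrams

open MvPowerSeries (coeff)

theorem rppCount_single_add_of_notMem (lam : YoungDiagram) (k : ℕ) {n : ℕ} {d : ℕ →₀ ℕ}
    (hn : n ∉ d.support) :
    rppCount lam (Finsupp.single n k + d) = layerSum k (fun mu => rppCount mu d) lam := by
  obtain ⟨N, hN⟩ := d.support.exists_nat_subset_range
  have hlt (m : ℕ) (hm : m ∈ d.support) : m < N := Finset.mem_range.mp (hN hm)
  have hfix : d.mapDomain (Equiv.swap n N) = d := by
    refine (Finsupp.mapDomain_congr fun m hm => ?_).trans Finsupp.mapDomain_id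
    exact Equiv.swap_apply_of_ne_of_ne (ne_of_mem_of_not_mem hm hn) (hlt m hm).ne
  rw [← rppCount_mapDomain lam _ (Equiv.swap n N).injective, Finsupp.mapDomain_add,
    Finsupp.mapDomain_single, Equiv.swap_apply_left, hfix, rppCount_single_add lam k hlt]

theorem rppCount_consExp (lam : YoungDiagram) (k : ℕ) (e : ℕ →₀ ℕ) :
    rppCount lam (consExp k e) = layerSum k (fun mu => rppCount mu e) lam := by
  have hzero : 0 ∉ (e.mapDomain Nat.succ).support :=
    Finsupp.notMem_support_iff.mpr (Finsupp.mapDomain_of_notMem_range _ _ (by simp))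
  rw [consExp, rppCount_single_add_of_notMem lam k hzero]
  simp only [rppCount_mapDomain _ _ Nat.succ_injective]

variable {K : Type*} [CommRing K]

theorem finsum_layerSum (φ : YoungDiagram → ℕ) (lam : YoungDiagram) :
    ∑ᶠ k, (layerSum k φ lam : K) = ∑ mu ∈ subdiagrams lam, (φ mu : K) := by
  rw [finsum_eq_sum_of_support_subset (s := (subdiagrams lam).image (colCount lam))]
  · simp only [layerSum, Nat.cast_sum]
    exact Finset.sum_fiberwise_of_maps_to (fun mu => Finset.mem_image_of_mem _) _
  · refine fun k hk => Finset.mem_coe.mpr ?_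
    by_contra hmem
    have hempty : (subdiagrams lam).filter (colCount lam · = k) = ∅ :=
      Finset.filter_eq_empty_iff.mpr fun mu hmu hcol => hmem (Finset.mem_image.mpr ⟨mu, hmu, hcol⟩)
    exact hk (by simp only [layerSum, hempty, Finset.sum_empty, Nat.cast_zero])

theorem coeff_sumMap (f : symmFunc K) (e : ℕ →₀ ℕ) :
    coeff e (sumMap (gBasis K) f : MvPowerSeries ℕ K) = coeffSum K (consCoeffs K e f) := by
  have hlin : coeff e ∘ₗ (symmFunc K).val.toLinearMap ∘ₗ sumMap (gBasis K) =
      coeffSum K ∘ₗ consCoeffs K e := by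
    refine (gBasis K).ext fun lam => ?_
    have hcoeff (k : ℕ) : consCoeffs K e (gSymm K lam) k =
        (layerSum k (fun mu => rppCount mu e) lam : K) := by
      rw [← rppCount_consExp]
      rfl
    simp only [LinearMap.comp_apply, gBasis_apply, coeffSum_eq_finsum, hcoeff, finsum_layerSum]
    rw [← gBasis_apply, sumMap, Module.Basis.constr_basis, map_sum, map_sum]
    refine Finset.sum_congr rfl fun mu _ => ?_
    rw [gBasis_apply]
    rfl
  exact LinearMap.congr_fun hlin f

theorem sumMap_eq_substSeq (f : symmFunc K) :
    (sumMap (gBasis K) f : MvPowerSeries ℕ K) =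
      substSeq (oneVars K) (f : MvPowerSeries ℕ K) :=
  MvPowerSeries.ext fun e => (coeff_sumMap f e).trans (coeffSum_consCoeffs f e)

end SumOverSubdiagrams

section EvalTensorId

open MvPowerSeries (coeff)

variable {K : Type*} [CommRing K]

theorem coeff_coproduct (f : symmFunc K) (k : ℕ) (e : ℕ →₀ ℕ) :
    coeff (Finsupp.sumElim (consExp k 0) e) (tensorToSeries K (coproduct K f)) =
      coeff (consExp k e) (f : MvPowerSeries ℕ K) := by
  let ψ : ℕ → ℕ ⊕ ℕ := fun n => Nat.casesOn n (Sum.inl 0) Sum.inr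
  have hψ : Function.Injective ψ := by
    rintro (_ | m) (_ | n) h
    · rfl
    · exact absurd h Sum.inl_ne_inr
    · exact absurd h Sum.inr_ne_inl
    · exact congrArg Nat.succ (Sum.inr_injective h)
  have hmap : Finsupp.sumElim (consExp k 0) e = (consExp k e).mapDomain ψ := by
    rw [consExp, consExp, Finsupp.mapDomain_zero, add_zero, Finsupp.sumElim_eq_add,
      Finsupp.mapDomain_add, ← Finsupp.mapDomain_comp, Finsupp.mapDomain_single,
      Finsupp.mapDomain_single]
    rfl
  rw [isCoproduct_coproduct, hmap, coeff_doubleVars_mapDomain f.2 hψ]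

variable (K)

/-- The analogue of `consCoeffs` on `Λ ⊗ Λ`, seen as a space of series in `x` and `y`: the
coefficients of the polynomial in `x₁` that stands at the monomial in `y` with exponent `e`, after
`x₂, x₃, …` have been set to `0`. -/
def tensorConsCoeffs (e : ℕ →₀ ℕ) : symmFunc K ⊗[K] symmFunc K →ₗ[K] (ℕ →₀ K) :=
  (TensorProduct.rid K (ℕ →₀ K)).toLinearMap ∘ₗ
    TensorProduct.map (consCoeffs K 0) (coeff e ∘ₗ (symmFunc K).val.toLinearMap)

variable {K}

theorem tensorConsCoeffs_tmul (e : ℕ →₀ ℕ) (u v : symmFunc K) :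
    tensorConsCoeffs K e (u ⊗ₜ v) = coeff e (v : MvPowerSeries ℕ K) • consCoeffs K 0 u :=
  rfl

theorem tensorConsCoeffs_apply (e : ℕ →₀ ℕ) (z : symmFunc K ⊗[K] symmFunc K) (k : ℕ) :
    tensorConsCoeffs K e z k = coeff (Finsupp.sumElim (consExp k 0) e) (tensorToSeries K z) := by
  induction z with
  | zero => simp only [map_zero, Finsupp.coe_zero, Pi.zero_apply]
  | add z z' hz hz' => rw [map_add, map_add, map_add, Finsupp.add_apply, hz, hz']
  | tmul u v =>
    rw [tensorConsCoeffs_tmul, coeff_tensorToSeries_tmul, Finsupp.smul_apply, smul_eq_mul,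
      mul_comm, consCoeffs_apply]

theorem tensorConsCoeffs_coproduct (e : ℕ →₀ ℕ) (f : symmFunc K) :
    tensorConsCoeffs K e (coproduct K f) = consCoeffs K e f :=
  Finsupp.ext fun k => (tensorConsCoeffs_apply e _ k).trans (coeff_coproduct f k e)

theorem coeff_lid_rTensor_evalOne (z : symmFunc K ⊗[K] symmFunc K) (e : ℕ →₀ ℕ) :
    coeff e ((TensorProduct.lid K (symmFunc K) ((evalOne K).rTensor (symmFunc K) z) :
      symmFunc K) : MvPowerSeries ℕ K) = coeffSum K (tensorConsCoeffs K e z) := by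
  induction z with
  | zero => simp only [map_zero, ZeroMemClass.coe_zero]
  | add z z' hz hz' => rw [map_add, map_add, Subalgebra.coe_add, map_add, hz, hz', map_add, map_add]
  | tmul u v =>
    rw [LinearMap.rTensor_tmul, TensorProduct.lid_tmul, tensorConsCoeffs_tmul, map_smul,
      coeffSum_consCoeffs_zero, Subalgebra.coe_smul, map_smul, smul_eq_mul, smul_eq_mul, mul_comm]

variable (K)

theorem sumMap_eq_comp_coproduct :
    sumMap (gBasis K) = (TensorProduct.lid K (symmFunc K)).toLinearMap ∘ₗ
      LinearMap.rTensor (symmFunc K) (evalOne K) ∘ₗ coproduct K := by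
  refine LinearMap.ext fun f => Subtype.ext (MvPowerSeries.ext fun e => ?_)
  rw [coeff_sumMap, ← tensorConsCoeffs_coproduct]
  exact (coeff_lid_rTensor_evalOne _ e).symm

end EvalTensorId

end

end DualGrothendieck

/-- The `g_lam` form a basis `b` of `Λ`, the coproduct `Δ` of `Λ` exists and is unique, and the
linear map `I` with `I(g_lam) = ∑ mu ⊂ lam, g_mu` satisfies `I(f) = f(1, x₁, x₂, …)` for all
`f ∈ Λ` and `I = (i ⊗ id) ∘ Δ`. -/
theorem mainTheorem3 (K : Type*) [CommRing K] :
    ∃ b : Module.Basis YoungDiagram K (DualGrothendieck.symmFunc K),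
      (∀ lam : YoungDiagram, (b lam : MvPowerSeries ℕ K) = DualGrothendieck.g K lam) ∧
      (∀ f : DualGrothendieck.symmFunc K,
        (DualGrothendieck.sumMap b f : MvPowerSeries ℕ K) =
          DualGrothendieck.substSeq (DualGrothendieck.oneVars K) (f : MvPowerSeries ℕ K)) ∧
      ∃ Δ : DualGrothendieck.symmFunc K →ₗ[K]
          DualGrothendieck.symmFunc K ⊗[K] DualGrothendieck.symmFunc K,
        (∀ Δ', DualGrothendieck.IsCoproduct Δ' ↔ Δ' = Δ) ∧
        DualGrothendieck.sumMap b =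
          (TensorProduct.lid K (DualGrothendieck.symmFunc K)).toLinearMap ∘ₗ
            LinearMap.rTensor (DualGrothendieck.symmFunc K) (DualGrothendieck.evalOne K) ∘ₗ Δ := by
  exact ⟨DualGrothendieck.gBasis K,
    fun lam => congrArg Subtype.val (DualGrothendieck.gBasis_apply K lam),
    DualGrothendieck.sumMap_eq_substSeq, DualGrothendieck.coproduct K,
    DualGrothendieck.isCoproduct_iff, DualGrothendieck.sumMap_eq_comp_coproduct K⟩
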